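/- Let $\Bbbk$ be a field and let $H$ be a finite-dimensional Hopf $\Bbbk$-algebra with coproduct $\Delta$, counit $\varepsilon$ and antipode $S$ (which is bijective), and let $\hat H$ be its dual Hopf algebra, with $(\omega\theta)(h)=\omega(h_{(1)})\theta(h_{(2)})$, coproduct $\hat\Delta(\omega)=\omega_{(1)}\otimes\omega_{(2)}$ given by $\omega_{(1)}(h)\,\omega_{(2)}(h')=\omega(hh')$, and $\hat\varepsilon(\omega)=\omega(1)$. Let $\mathbf p(h,\omega)=\omega(h)$, let $U=\sum_i h_i\otimes h^i\in H\otimes\hat H$ be the canonical element ($(h_i)$ a basis of $H$ with dual basis $(h^i)$), and let ${}^{\circ}U=\sum_i h_i^{\mathrm{op}}\otimes h^i\in H^{\mathrm{op}}\otimes\hat H$, where $H^{\mathrm{op}}$ has the coproduct of $H$ and the opposite product. This element is invertible. Write $\mathrm{Ad}(W)(z)=WzW^{-1}$, and let $\Sigma$ denote flips of tensor factors. For $h\in H$, $\omega\in\hat H$, let $h\blacktriangleright\omega$ be the form $x\mapsto\omega(xh)$ and $\omega\blacktriangleleft h$ the form $x\mapsto\omega(hx)$. * The Radford codouble $\mathcal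 T_R(H)$ is the tensor product algebra $H^{\mathrm{op}}\otimes\hat H$ with coproduct $(\mathrm{id}\otimes\Sigma\,\mathrm{Ad}({}^{\circ}U)\otimes\mathrm{id})(\Delta_{H^{\mathrm{op}}}\otimes\hat\Delta)$ and counit $\varepsilon\otimes\hat\varepsilon$. * The Radford double $\mathcal D_R(H)$ is the space $\hat H\otimes H$ (elements written $\omega\bowtie h$) with product $(\omega\bowtie a)(\theta\bowtie b)=\omega\,(a_{(1)}\blacktriangleright\theta\blacktriangleleft S^{-1}(a_{(3)}))\bowtie a_{(2)}b$, unit $\varepsilon\bowtie 1$, coproduct $\Delta(\omega\bowtie h)=(\omega_{(2)}\bowtie h_{(1)})\otimes(\omega_{(1)}\bowtie h_{(2)})$ and counit $\omega\bowtie h\mapsto\omega(1)\varepsilon(h)$. It is paired with $\mathcal T_R(H)$ by $\mathbf p_{\mathcal D}(\omega\bowtie h,c^{\mathrm{op}}\otimes\theta)=\omega(c)\,\theta(h)$. All algebras $X$ are unital $\Bbbk$-algebras, coactions are unital algebra homomorphisms, coassociative and counital, and a left action $\rhd$ of a Hopf algebra $A$ on $X$ is a linear unital left module structure with $a\rhd(xy)=(a_{(1)}\rhd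 x)(a_{(2)}\rhd y)$ and $a\rhd 1=\varepsilon(a)1$. Consider the following categories, whose morphisms are the algebra homomorphisms compatible with the given actions and coactions: * $\mathfrak{YD}^{rr}(H,\hat H)$: triples $(X,\alpha,\beta)$ with right coactions $\alpha:X\to X\otimes H^{\mathrm{op}}$ of $H^{\mathrm{op}}$ and $\beta:X\to X\otimes\hat H$ of $\hat H$ such that $(\alpha\otimes\mathrm{id})\beta=(\mathrm{id}_X\otimes\mathrm{Ad}({}^{\circ}U)^{-1})(\mathrm{id}_X\otimes\Sigma)(\beta\otimes\mathrm{id})\alpha$ (right-right $(H,\hat H)$-Yetter–Drinfeld algebras); * $\mathfrak{Alg}^{\mathcal T_R(H)}$: right $\mathcal T_R(H)$-comodule algebras $(X,\gamma)$; * ${}_H\mathfrak{YD}^H$: triples $(X,\rhd,\alpha)$ with a left action $\rhd$ of $H$ and a right coaction $\alpha:X\to X\otimes H^{\mathrm{op}}$, $x\mapsto x_{[0]}\otimes x_{[1]}^{\mathrm{op}}$, of $H^{\mathrm{op}}$ such that $(h_{(1)}\rhd x_{[0]})\otimes h_{(2)}x_{[1]}=(h_{(2)}\rhd x)_{[0]}\otimes(h_{(2)}\rhd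 x)_{[1]}h_{(1)}$ for all $h\in H$, $x\in X$ (left-right Yetter–Drinfeld algebras over $H$); * ${}_{\mathcal D_R(H)}\mathfrak{Alg}$: left $\mathcal D_R(H)$-module algebras. **Proposition.** The following four functors, all of which are the identity on underlying algebras and on morphisms, are well defined and are equivalences of categories: 1. $\mathfrak E'_R:\mathfrak{YD}^{rr}(H,\hat H)\to\mathfrak{Alg}^{\mathcal T_R(H)}$, $(X,\alpha,\beta)\mapsto(X,\gamma)$ with $\gamma=(\alpha\otimes\mathrm{id})\beta$; 2. $\mathfrak{YD}^{rr}(H,\hat H)\to{}_H\mathfrak{YD}^H$, $(X,\alpha,\beta)\mapsto(X,\rhd_\beta,\alpha)$ with $h\rhd_\beta x=(\mathrm{id}\otimes\mathbf p(h,\cdot))(\beta(x))$; 3. $\mathfrak{Alg}^{\mathcal T_R(H)}\to{}_{\mathcal D_R(H)}\mathfrak{Alg}$, $(X,\gamma)\mapsto(X,\rhd_\gamma)$ with $d\rhd_\gamma x=(\mathrm{id}\otimes\mathbf p_{\mathcal D}(d,\cdot))(\gamma(x))$; 4. $\mathfrak E_R:{}_H\mathfrak{YD}^H\to{}_{\mathcal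 D_R(H)}\mathfrak{Alg}$, $(X,\rhd,\alpha)\mapsto(X,\cdot)$ with $(\omega\bowtie h)\cdot x=(\mathrm{id}\otimes\mathbf p(\cdot,\omega))(\alpha(h\rhd x))$ (Radford's equivalence). The square they form commutes: the composite of 1 and 3 equals the composite of 2 and 4. -/

import Mathlib

/-!
Right-right Yetter-Drinfeld algebras over a finite-dimensional Hopf algebra `H`, comodule algebras
over the Drinfeld codouble of `H`, left-right Yetter-Drinfeld algebras over `H`, and module algebras
over the Drinfeld double of `H` (Radford's version).
-/

open CategoryTheory TensorProduct Coalgebra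

universe u v w

noncomputable section

namespace RadfordYD

/-! ### Actions and coactions on algebras -/

section ActionsCoactions

variable (k : Type u) [Field k]

/-- `δ : X → X ⊗ A` is a right coaction of the bialgebra `A` on the algebra `X`
(it is a homomorphism of unital algebras since it is given as an `AlgHom`). -/
structure IsRightCoaction (A : Type*) [Ring A] [Algebra k A] [CoalgebraStruct k A]
    {X : Type*} [Ring X] [Algebra k X] (δ : X →ₐ[k] X ⊗[k] A) : Prop where
  /-- `(δ ⊗ id) δ = (id ⊗ Δ) δ` -/
  coassoc : (TensorProduct.assoc k X A A).toLinearMap ∘ₗ δ.toLinearMap.rTensor A ∘ₗ δ.toLinearMap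
    = (comul (R := k) (A := A)).lTensor X ∘ₗ δ.toLinearMap
  /-- `(id ⊗ ε) δ = id` -/
  counit_id : (TensorProduct.rid k X).toLinearMap ∘ₗ (counit (R := k) (A := A)).lTensor X
    ∘ₗ δ.toLinearMap = LinearMap.id

/-- `act : A → End X`, `a ↦ (x ↦ a ▷ x)` makes the algebra `X` a left `A`-module algebra. -/
structure IsLeftModuleAlgebra (A : Type*) [AddCommGroup A] [Module k A] [Mul A] [One A]
    [CoalgebraStruct k A] {X : Type*} [Ring X] [Algebra k X] (act : A →ₗ[k] X →ₗ[k] X) : Prop where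
  one_act : ∀ x : X, act 1 x = x
  mul_act : ∀ (a b : A) (x : X), act (a * b) x = act a (act b x)
  /-- `a ▷ (x y) = (a₁ ▷ x) (a₂ ▷ y)` -/
  act_mul : ∀ (a : A) (x y : X), act a (x * y) =
    LinearMap.mul' k X (TensorProduct.map (act.flip x) (act.flip y) (comul (R := k) a))
  /-- `a ▷ 1 = ε(a) 1` -/
  act_one : ∀ a : A, act a (1 : X) = counit (R := k) a • (1 : X)

variable {k}

/-- The map `b ▷ x = (id ⊗ p(b, ·)) (δ x)` induced by a map `δ : X → X ⊗ A` and a pairing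
`p : B × A → k`. -/
def inducedAction {A B X : Type*} [AddCommGroup A] [Module k A] [AddCommGroup B] [Module k B]
    [Ring X] [Algebra k X] (p : B →ₗ[k] A →ₗ[k] k) (δ : X →ₗ[k] X ⊗[k] A) :
    B →ₗ[k] X →ₗ[k] X :=
  LinearMap.mk₂ k (fun b x => TensorProduct.rid k X ((p b).lTensor X (δ x)))
    (fun b b' x => by simp [LinearMap.lTensor_add]) (fun c b x => by simp [LinearMap.lTensor_smul])
    (fun b x x' => by simp) (fun c b x => by simp)

/-- `Ad(W)(z) = W z W⁻¹`, for an invertible element `W`. -/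
def Ad {A : Type*} [Ring A] [Algebra k A] (W : A) : A →ₗ[k] A :=
  LinearMap.mulLeft k W ∘ₗ LinearMap.mulRight k (Ring.inverse W)

/-- The comultiplication `(id ⊗ Σ Ad(W) ⊗ id) (Δ_A ⊗ Δ_B)` on `A ⊗ B`, for `W` in `A ⊗ B`. -/
def twistedComul {A B : Type*} [Ring A] [Algebra k A] [CoalgebraStruct k A] [Ring B] [Algebra k B]
    [CoalgebraStruct k B] (W : A ⊗[k] B) : A ⊗[k] B →ₗ[k] (A ⊗[k] B) ⊗[k] (A ⊗[k] B) :=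
  (TensorProduct.tensorTensorTensorComm k A A B B).toLinearMap
    ∘ₗ (TensorProduct.tensorTensorTensorAssoc k A A B B).symm.toLinearMap
    ∘ₗ ((Ad W).lTensor A).rTensor B
    ∘ₗ (TensorProduct.tensorTensorTensorAssoc k A A B B).toLinearMap
    ∘ₗ TensorProduct.map (comul (R := k) (A := A)) (comul (R := k) (A := B))

/-- The multiplication `(m_A ⊗ m_B) (id ⊗ T ⊗ id)` on `A ⊗ B`, for `T : B ⊗ A → A ⊗ B`. -/
def twistedMul {A B : Type*} [Ring A] [Algebra k A] [Ring B] [Algebra k B]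
    (T : B ⊗[k] A →ₗ[k] A ⊗[k] B) : (A ⊗[k] B) ⊗[k] (A ⊗[k] B) →ₗ[k] A ⊗[k] B :=
  TensorProduct.map (LinearMap.mul' k A) (LinearMap.mul' k B)
    ∘ₗ (TensorProduct.tensorTensorTensorAssoc k A A B B).symm.toLinearMap
    ∘ₗ (T.lTensor A).rTensor B
    ∘ₗ (TensorProduct.tensorTensorTensorAssoc k A B A B).toLinearMap

/-- The counit `ε_A ⊗ ε_B` on `A ⊗ B`. -/
def tensorCounit (A B : Type*) [Ring A] [Algebra k A] [CoalgebraStruct k A] [Ring B] [Algebra k B]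
    [CoalgebraStruct k B] : A ⊗[k] B →ₗ[k] k :=
  LinearMap.mul' k k ∘ₗ TensorProduct.map (counit (R := k) (A := A)) (counit (R := k) (A := B))

/-- The comultiplication `a ⊗ b ↦ (a₂ ⊗ b₁) ⊗ (a₁ ⊗ b₂)` of `Aᶜᵒ ⊗ B` on `A ⊗ B`. -/
def coTensorComul (A B : Type*) [Ring A] [Algebra k A] [CoalgebraStruct k A] [Ring B] [Algebra k B]
    [CoalgebraStruct k B] : A ⊗[k] B →ₗ[k] (A ⊗[k] B) ⊗[k] (A ⊗[k] B) :=
  (TensorProduct.tensorTensorTensorComm k A A B B).toLinearMap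
    ∘ₗ TensorProduct.map ((TensorProduct.comm k A A).toLinearMap ∘ₗ comul (R := k) (A := A))
      (comul (R := k) (A := B))

/-- The pairing `(a ⊗ b, a' ⊗ b') ↦ p(a, a') q(b, b')` of `A ⊗ B` with `A' ⊗ B'`. -/
def tensorPairing {A B A' B' : Type*} [AddCommGroup A] [Module k A] [AddCommGroup B] [Module k B]
    [AddCommGroup A'] [Module k A'] [AddCommGroup B'] [Module k B']
    (p : A →ₗ[k] A' →ₗ[k] k) (q : B →ₗ[k] B' →ₗ[k] k) :
    A ⊗[k] B →ₗ[k] A' ⊗[k] B' →ₗ[k] k :=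
  TensorProduct.dualDistrib k A' B' ∘ₗ TensorProduct.map p q

end ActionsCoactions

/-! ### The dual Hopf algebra -/

section Dual

variable (k : Type u) (H : Type v) [Field k] [Ring H] [HopfAlgebra k H]

/-- The dual `Ĥ` of `H`, with the convolution algebra structure: `(ω θ)(h) = ω(h₁) θ(h₂)`, and the
unit is `ε`. -/
def HDual : Type _ := WithConv (H →ₗ[k] k)

instance : Ring (HDual k H) := inferInstanceAs (Ring (WithConv (H →ₗ[k] k)))

instance : Algebra k (HDual k H) := inferInstanceAs (Algebra k (WithConv (H →ₗ[k] k)))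

/-- The identification of the space of linear forms on `H` with the underlying space of `Ĥ`. -/
def toHDual : Module.Dual k H ≃ₗ[k] HDual k H where
  toFun f := WithConv.toConv f
  invFun ω := WithConv.ofConv ω
  map_add' _ _ := rfl
  map_smul' _ _ := rfl
  left_inv _ := rfl
  right_inv _ := rfl

/-- The canonical pairing `p(h, ω) = ω(h)`. -/
def pairing : H →ₗ[k] HDual k H →ₗ[k] k :=
  (toHDual k H).symm.toLinearMap.flip

/-- The canonical pairing `(ω, cᵒᵖ) ↦ ω(c)` of `Ĥᶜᵒ` with `Hᵒᵖ`. -/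
def pairingOp : HDual k H →ₗ[k] Hᵐᵒᵖ →ₗ[k] k :=
  (pairing k H).flip.compl₂ (MulOpposite.opLinearEquiv k).symm.toLinearMap

variable [FiniteDimensional k H]

/-- The coalgebra structure of `Ĥ`: `ω₁(h) ω₂(h') = ω(h h')` and `ε(ω) = ω(1)`. -/
instance : CoalgebraStruct k (HDual k H) where
  comul := TensorProduct.map (toHDual k H).toLinearMap (toHDual k H).toLinearMap
    ∘ₗ (TensorProduct.dualDistribEquiv k H H).symm.toLinearMap
    ∘ₗ (LinearMap.mul' k H).dualMap ∘ₗ (toHDual k H).symm.toLinearMap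
  counit := pairing k H 1

/-- The canonical element `U = ∑ hᵢ ⊗ hⁱ` of `H ⊗ Ĥ`. -/
def canU : H ⊗[k] HDual k H :=
  (toHDual k H).toLinearMap.lTensor H (coevaluation k H 1)

/-- The element `°U = (op ⊗ id)(U)` of the algebra `Hᵒᵖ ⊗ Ĥ`. -/
def canUop : Hᵐᵒᵖ ⊗[k] HDual k H :=
  (MulOpposite.opLinearEquiv k).toLinearMap.rTensor (HDual k H) (canU k H)

end Dual

/-! ### The Drinfeld codouble and the Drinfeld double -/

section Doubles

variable (k : Type u) (H : Type v) [Field k] [Ring H] [HopfAlgebra k H]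

/-- The Drinfeld codouble `T_R(H)`. As an algebra it is the tensor product `Hᵒᵖ ⊗ Ĥ`. -/
def Codouble : Type _ := Hᵐᵒᵖ ⊗[k] HDual k H

instance : Ring (Codouble k H) := inferInstanceAs (Ring (Hᵐᵒᵖ ⊗[k] HDual k H))

instance : Algebra k (Codouble k H) := inferInstanceAs (Algebra k (Hᵐᵒᵖ ⊗[k] HDual k H))

/-- The coalgebra structure of `T_R(H)`: the comultiplication is
`(id ⊗ Σ Ad(°U) ⊗ id) (Δ ⊗ Δ̂)`. -/
instance [FiniteDimensional k H] : CoalgebraStruct k (Codouble k H) where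
  comul := twistedComul (canUop k H)
  counit := tensorCounit Hᵐᵒᵖ (HDual k H)

/-- The inverse `S⁻¹` of the antipode. -/
def antipodeInv : H →ₗ[k] H := Ring.inverse (HopfAlgebra.antipode k : Module.End k H)

/-- The regular action of `H` on the left of `Ĥ`: `h ▶ ω = ω₁ p(h, ω₂)` is the linear form
`x ↦ ω(x h)`. -/
def regularLeft : H →ₗ[k] HDual k H →ₗ[k] HDual k H :=
  LinearMap.mk₂ k (fun h ω => toHDual k H ((toHDual k H).symm ω ∘ₗ LinearMap.mulRight k h))
    (fun _ _ _ => by rw [← map_add]; congr 1; ext; simp [mul_add])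
    (fun _ _ _ => by rw [← map_smul]; congr 1; ext; simp)
    (fun _ _ _ => rfl) (fun _ _ _ => rfl)

/-- The regular action of `H` on the right of `Ĥ`: `ω ◀ h = p(h, ω₁) ω₂` is the linear form
`x ↦ ω(h x)`. -/
def regularRight : HDual k H →ₗ[k] H →ₗ[k] HDual k H :=
  LinearMap.mk₂ k (fun ω h => toHDual k H ((toHDual k H).symm ω ∘ₗ LinearMap.mulLeft k h))
    (fun _ _ _ => rfl) (fun _ _ _ => rfl)
    (fun _ _ _ => by rw [← map_add]; congr 1; ext; simp [add_mul])
    (fun _ _ _ => by rw [← map_smul]; congr 1; ext; simp)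

/-- The map `ω ↦ (a ⊗ b ↦ a ▶ ω ◀ S⁻¹(b))`. -/
def coadjointAux : HDual k H →ₗ[k] H ⊗[k] H →ₗ[k] HDual k H where
  toFun ω := TensorProduct.lift
    ((regularRight k H ∘ₗ (regularLeft k H).flip ω).compl₂ (antipodeInv k H))
  map_add' _ _ := TensorProduct.ext' fun _ _ => by simp
  map_smul' _ _ := TensorProduct.ext' fun _ _ => by simp

/-- The exchange map `H ⊗ Ĥ → Ĥ ⊗ H`, `a ⊗ ω ↦ (a₁ ▶ ω ◀ S⁻¹(a₃)) ⊗ a₂`. -/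
def exchange : H ⊗[k] HDual k H →ₗ[k] HDual k H ⊗[k] H :=
  TensorProduct.lift <| LinearMap.mk₂ k
    (fun a ω => (coadjointAux k H ω).rTensor H
      (TensorProduct.rightComm k H H H ((comul (R := k) (A := H)).rTensor H (comul (R := k) a))))
    (fun _ _ _ => by simp) (fun _ _ _ => by simp)
    (fun _ _ _ => by simp [LinearMap.rTensor_add]) (fun _ _ _ => by simp [LinearMap.rTensor_smul])

/-- The Drinfeld double `D_R(H) = Ĥᶜᵒ ⋈ H`, with underlying space `Ĥ ⊗ H`. -/
def Double : Type _ := HDual k H ⊗[k] H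

instance : AddCommGroup (Double k H) := inferInstanceAs (AddCommGroup (HDual k H ⊗[k] H))

instance : Module k (Double k H) := inferInstanceAs (Module k (HDual k H ⊗[k] H))

/-- The multiplication of `D_R(H)`: `(ω ⋈ a) (θ ⋈ b) = ω (a₁ ▶ θ ◀ S⁻¹(a₃)) ⋈ a₂ b`. -/
instance : Mul (Double k H) where
  mul d e := twistedMul (exchange k H) (TensorProduct.tmul k d e)

instance : One (Double k H) where
  one := (TensorProduct.tmul k 1 1 : HDual k H ⊗[k] H)

/-- The coalgebra structure of `D_R(H)`: `Δ(ω ⋈ a) = (ω₂ ⋈ a₁) ⊗ (ω₁ ⋈ a₂)`. -/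
instance [FiniteDimensional k H] : CoalgebraStruct k (Double k H) where
  comul := coTensorComul (HDual k H) H
  counit := tensorCounit (HDual k H) H

/-- The canonical pairing `p_D(ω ⋈ h, cᵒᵖ ⊗ θ) = ω(c) θ(h)` of `D_R(H)` with `T_R(H)`. -/
def pairingDouble : Double k H →ₗ[k] Codouble k H →ₗ[k] k :=
  tensorPairing (pairingOp k H) (pairing k H)

end Doubles

/-! ### Yetter-Drinfeld algebras -/

section YetterDrinfeld

variable (k : Type u) (H : Type v) [Field k] [Ring H] [HopfAlgebra k H]

/-- `(X, ▷, δ)` is a left-right Yetter-Drinfeld algebra over `H`. -/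
structure IsLeftRightYD {X : Type w} [Ring X] [Algebra k X] (act : H →ₗ[k] X →ₗ[k] X)
    (δ : X →ₐ[k] X ⊗[k] Hᵐᵒᵖ) : Prop where
  isLeftModuleAlgebra : IsLeftModuleAlgebra k H act
  isRightCoaction : IsRightCoaction k Hᵐᵒᵖ δ
  /-- `(h₁ ▷ x₀) ⊗ h₂ x₁ = (h₂ ▷ x)₀ ⊗ (h₂ ▷ x)₁ h₁` in `X ⊗ H` -/
  compat : ∀ (h : H) (x : X),
    TensorProduct.map (TensorProduct.lift act)
        (LinearMap.mul' k H ∘ₗ (MulOpposite.opLinearEquiv k).symm.toLinearMap.lTensor H)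
        (TensorProduct.tensorTensorTensorComm k H H X Hᵐᵒᵖ (comul (R := k) h ⊗ₜ[k] δ x)) =
      (LinearMap.mul' k H ∘ₗ (TensorProduct.comm k H H).toLinearMap
          ∘ₗ (MulOpposite.opLinearEquiv k).symm.toLinearMap.lTensor H).lTensor X
        (TensorProduct.leftComm k H X Hᵐᵒᵖ
          ((δ.toLinearMap ∘ₗ act.flip x).lTensor H (comul (R := k) h)))

/-- `(X, α, β)` is a right-right `(H, Ĥ)`-Yetter-Drinfeld algebra. -/
structure IsRightRightYD [FiniteDimensional k H] {X : Type w} [Ring X] [Algebra k X]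
    (α : X →ₐ[k] X ⊗[k] Hᵐᵒᵖ) (β : X →ₐ[k] X ⊗[k] HDual k H) : Prop where
  isRightCoaction_left : IsRightCoaction k Hᵐᵒᵖ α
  isRightCoaction_right : IsRightCoaction k (HDual k H) β
  /-- `(α ⊗ id) β = (id ⊗ Ad(°U)⁻¹) (id ⊗ Σ) (β ⊗ id) α` in `X ⊗ Hᵒᵖ ⊗ Ĥ` -/
  compat : (TensorProduct.assoc k X Hᵐᵒᵖ (HDual k H)).toLinearMap
      ∘ₗ α.toLinearMap.rTensor (HDual k H) ∘ₗ β.toLinearMap =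
    (Ad (k := k) (Ring.inverse (canUop k H))).lTensor X
      ∘ₗ (TensorProduct.comm k (HDual k H) Hᵐᵒᵖ).toLinearMap.lTensor X
      ∘ₗ (TensorProduct.assoc k X (HDual k H) Hᵐᵒᵖ).toLinearMap
      ∘ₗ β.toLinearMap.rTensor Hᵐᵒᵖ ∘ₗ α.toLinearMap

/-- The map `γ = (α ⊗ id) β : X → X ⊗ T_R(H)`. -/
def gamma {X : Type w} [Ring X] [Algebra k X] (α : X →ₐ[k] X ⊗[k] Hᵐᵒᵖ)
    (β : X →ₐ[k] X ⊗[k] HDual k H) : X →ₐ[k] X ⊗[k] Codouble k H :=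
  ((Algebra.TensorProduct.assoc k k k X Hᵐᵒᵖ (HDual k H)).toAlgHom.comp
    (Algebra.TensorProduct.map α (AlgHom.id k (HDual k H)))).comp β

/-- The action `h ▷_β x = (id ⊗ p(h, ·)) (β x)` of `H` induced by `β : X → X ⊗ Ĥ`. -/
def actionOfBeta {X : Type w} [Ring X] [Algebra k X] (β : X →ₐ[k] X ⊗[k] HDual k H) :
    H →ₗ[k] X →ₗ[k] X :=
  inducedAction (pairing k H) β.toLinearMap

/-- The action `d ▷_γ x = (id ⊗ p_D(d, ·)) (γ x)` of `D_R(H)` induced by `γ : X → X ⊗ T_R(H)`. -/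
def actionOfGamma {X : Type w} [Ring X] [Algebra k X] (γ : X →ₐ[k] X ⊗[k] Codouble k H) :
    Double k H →ₗ[k] X →ₗ[k] X :=
  inducedAction (pairingDouble k H) γ.toLinearMap

/-- The action `(ω ⋈ h) · x = (id ⊗ p(·, ω)) (δ (h ▷ x))` of `D_R(H)` built from an action `▷` of
`H` and `δ : X → X ⊗ Hᵒᵖ`. -/
def radfordAction {X : Type w} [Ring X] [Algebra k X] (act : H →ₗ[k] X →ₗ[k] X)
    (δ : X →ₐ[k] X ⊗[k] Hᵐᵒᵖ) : Double k H →ₗ[k] X →ₗ[k] X :=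
  TensorProduct.lift
    ((LinearMap.llcomp k X X X).compl₁₂ (inducedAction (pairingOp k H) δ.toLinearMap) act)

end YetterDrinfeld

/-! ### The four categories -/

section Categories

variable (k : Type u) [Field k]

/-- Right comodule algebras over `A`. -/
structure RightComoduleAlg (A : Type v) [Ring A] [Algebra k A] [CoalgebraStruct k A] where
  carrier : Type w
  [ring : Ring carrier]
  [algebra : Algebra k carrier]
  coact : carrier →ₐ[k] carrier ⊗[k] A
  isRightCoaction : IsRightCoaction k A coact

attribute [instance] RightComoduleAlg.ring RightComoduleAlg.algebra

variable {k} in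
/-- Algebra homomorphisms `f` with `(f ⊗ id) γ = γ' f`. -/
@[ext]
structure RightComoduleAlg.Hom {A : Type v} [Ring A] [Algebra k A] [CoalgebraStruct k A]
    (X Y : RightComoduleAlg.{u, v, w} k A) where
  hom : X.carrier →ₐ[k] Y.carrier
  comm : hom.toLinearMap.rTensor A ∘ₗ X.coact.toLinearMap = Y.coact.toLinearMap ∘ₗ hom.toLinearMap

instance (A : Type v) [Ring A] [Algebra k A] [CoalgebraStruct k A] :
    Category (RightComoduleAlg.{u, v, w} k A) where
  Hom := RightComoduleAlg.Hom
  id X := ⟨AlgHom.id k X.carrier, by ext; simp⟩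
  comp {X Y Z} f g := ⟨g.hom.comp f.hom, by
    rw [AlgHom.comp_toLinearMap, LinearMap.rTensor_comp, LinearMap.comp_assoc, f.comm,
      ← LinearMap.comp_assoc, g.comm, LinearMap.comp_assoc]⟩

/-- Left module algebras over `A`. -/
structure LeftModuleAlg (A : Type v) [AddCommGroup A] [Module k A] [Mul A] [One A]
    [CoalgebraStruct k A] where
  carrier : Type w
  [ring : Ring carrier]
  [algebra : Algebra k carrier]
  act : A →ₗ[k] carrier →ₗ[k] carrier
  isLeftModuleAlgebra : IsLeftModuleAlgebra k A act

attribute [instance] LeftModuleAlg.ring LeftModuleAlg.algebra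

variable {k} in
/-- Algebra homomorphisms `f` with `f (a ▷ x) = a ▷' f x`. -/
@[ext]
structure LeftModuleAlg.Hom {A : Type v} [AddCommGroup A] [Module k A] [Mul A] [One A]
    [CoalgebraStruct k A] (X Y : LeftModuleAlg.{u, v, w} k A) where
  hom : X.carrier →ₐ[k] Y.carrier
  comm : ∀ (a : A) (x : X.carrier), hom (X.act a x) = Y.act a (hom x)

instance (A : Type v) [AddCommGroup A] [Module k A] [Mul A] [One A] [CoalgebraStruct k A] :
    Category (LeftModuleAlg.{u, v, w} k A) where
  Hom := LeftModuleAlg.Hom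
  id X := ⟨AlgHom.id k X.carrier, fun _ _ => rfl⟩
  comp f g := ⟨g.hom.comp f.hom, fun a x => by simp [f.comm, g.comm]⟩

variable (H : Type v) [Ring H] [HopfAlgebra k H]

/-- Left-right Yetter-Drinfeld algebras over `H`. -/
structure LeftRightYD where
  carrier : Type w
  [ring : Ring carrier]
  [algebra : Algebra k carrier]
  act : H →ₗ[k] carrier →ₗ[k] carrier
  coact : carrier →ₐ[k] carrier ⊗[k] Hᵐᵒᵖ
  isLeftRightYD : IsLeftRightYD k H act coact

attribute [instance] LeftRightYD.ring LeftRightYD.algebra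

variable {k H} in
/-- Algebra homomorphisms compatible with the actions and with the coactions. -/
@[ext]
structure LeftRightYD.Hom (X Y : LeftRightYD.{u, v, w} k H) where
  hom : X.carrier →ₐ[k] Y.carrier
  comm_act : ∀ (h : H) (x : X.carrier), hom (X.act h x) = Y.act h (hom x)
  comm_coact : hom.toLinearMap.rTensor Hᵐᵒᵖ ∘ₗ X.coact.toLinearMap =
    Y.coact.toLinearMap ∘ₗ hom.toLinearMap

instance : Category (LeftRightYD.{u, v, w} k H) where
  Hom := LeftRightYD.Hom
  id X := ⟨AlgHom.id k X.carrier, fun _ _ => rfl, by ext; simp⟩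
  comp f g := ⟨g.hom.comp f.hom, fun a x => by simp [f.comm_act, g.comm_act], by
    rw [AlgHom.comp_toLinearMap, LinearMap.rTensor_comp, LinearMap.comp_assoc, f.comm_coact,
      ← LinearMap.comp_assoc, g.comm_coact, LinearMap.comp_assoc]⟩

variable [FiniteDimensional k H]

/-- Right-right `(H, Ĥ)`-Yetter-Drinfeld algebras. -/
structure RightRightYD where
  carrier : Type w
  [ring : Ring carrier]
  [algebra : Algebra k carrier]
  α : carrier →ₐ[k] carrier ⊗[k] Hᵐᵒᵖ
  β : carrier →ₐ[k] carrier ⊗[k] HDual k H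
  isRightRightYD : IsRightRightYD k H α β

attribute [instance] RightRightYD.ring RightRightYD.algebra

variable {k H} in
/-- Algebra homomorphisms `f` with `(f ⊗ id) α = α' f` and `(f ⊗ id) β = β' f`. -/
@[ext]
structure RightRightYD.Hom (X Y : RightRightYD.{u, v, w} k H) where
  hom : X.carrier →ₐ[k] Y.carrier
  comm_α : hom.toLinearMap.rTensor Hᵐᵒᵖ ∘ₗ X.α.toLinearMap = Y.α.toLinearMap ∘ₗ hom.toLinearMap
  comm_β : hom.toLinearMap.rTensor (HDual k H) ∘ₗ X.β.toLinearMap =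
    Y.β.toLinearMap ∘ₗ hom.toLinearMap

instance : Category (RightRightYD.{u, v, w} k H) where
  Hom := RightRightYD.Hom
  id X := ⟨AlgHom.id k X.carrier, by ext; simp, by ext; simp⟩
  comp f g := ⟨g.hom.comp f.hom,
    by rw [AlgHom.comp_toLinearMap, LinearMap.rTensor_comp, LinearMap.comp_assoc, f.comm_α,
      ← LinearMap.comp_assoc, g.comm_α, LinearMap.comp_assoc],
    by rw [AlgHom.comp_toLinearMap, LinearMap.rTensor_comp, LinearMap.comp_assoc, f.comm_β,
      ← LinearMap.comp_assoc, g.comm_β, LinearMap.comp_assoc]⟩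

end Categories

/-! ### The four functors

Each functor is the identity on underlying algebras and on morphisms. The argument of each definition
is the assertion that the functor is well defined on objects. -/

section Functors

variable {k : Type u} {H : Type v} [Field k] [Ring H] [HopfAlgebra k H]

lemma inducedAction_comm {A B X Y : Type*} [AddCommGroup A] [Module k A] [AddCommGroup B]
    [Module k B] [Ring X] [Algebra k X] [Ring Y] [Algebra k Y] (p : B →ₗ[k] A →ₗ[k] k)
    {δ : X →ₗ[k] X ⊗[k] A} {δ' : Y →ₗ[k] Y ⊗[k] A} (f : X →ₐ[k] Y)
    (h : f.toLinearMap.rTensor A ∘ₗ δ = δ' ∘ₗ f.toLinearMap) (b : B) (x : X) :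
    f (inducedAction p δ b x) = inducedAction p δ' b (f x) := by
  have h' : δ' (f x) = f.toLinearMap.rTensor A (δ x) := (LinearMap.congr_fun h x).symm
  simp only [inducedAction, LinearMap.mk₂_apply, h']
  generalize δ x = t
  induction t with
  | zero => simp
  | add s t hs ht => simp [hs, ht]
  | tmul y a => simp

lemma radfordAction_comm {X Y : Type w} [Ring X] [Algebra k X] [Ring Y] [Algebra k Y]
    {act : H →ₗ[k] X →ₗ[k] X} {δ : X →ₐ[k] X ⊗[k] Hᵐᵒᵖ}
    {act' : H →ₗ[k] Y →ₗ[k] Y} {δ' : Y →ₐ[k] Y ⊗[k] Hᵐᵒᵖ} (f : X →ₐ[k] Y)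
    (hact : ∀ (h : H) (x : X), f (act h x) = act' h (f x))
    (hδ : f.toLinearMap.rTensor Hᵐᵒᵖ ∘ₗ δ.toLinearMap = δ'.toLinearMap ∘ₗ f.toLinearMap)
    (d : Double k H) (x : X) :
    f (radfordAction k H act δ d x) = radfordAction k H act' δ' d (f x) := by
  have h (t : HDual k H ⊗[k] H) : f (TensorProduct.lift ((LinearMap.llcomp k X X X).compl₁₂
      (inducedAction (pairingOp k H) δ.toLinearMap) act) t x) =
      TensorProduct.lift ((LinearMap.llcomp k Y Y Y).compl₁₂
        (inducedAction (pairingOp k H) δ'.toLinearMap) act') t (f x) := by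
    induction t with
    | zero => simp
    | add s t hs ht => simp [hs, ht]
    | tmul ω h => simp [inducedAction_comm _ f hδ, hact]
  exact h d

lemma gamma_comm {X Y : Type w} [Ring X] [Algebra k X] [Ring Y] [Algebra k Y]
    {α : X →ₐ[k] X ⊗[k] Hᵐᵒᵖ} {β : X →ₐ[k] X ⊗[k] HDual k H}
    {α' : Y →ₐ[k] Y ⊗[k] Hᵐᵒᵖ} {β' : Y →ₐ[k] Y ⊗[k] HDual k H} (f : X →ₐ[k] Y)
    (hα : f.toLinearMap.rTensor Hᵐᵒᵖ ∘ₗ α.toLinearMap = α'.toLinearMap ∘ₗ f.toLinearMap)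
    (hβ : f.toLinearMap.rTensor (HDual k H) ∘ₗ β.toLinearMap =
      β'.toLinearMap ∘ₗ f.toLinearMap) :
    f.toLinearMap.rTensor (Codouble k H) ∘ₗ (gamma k H α β).toLinearMap =
      (gamma k H α' β').toLinearMap ∘ₗ f.toLinearMap := by
  refine LinearMap.ext fun x => ?_
  have hβ' : β' (f x) = f.toLinearMap.rTensor (HDual k H) (β x) := (LinearMap.congr_fun hβ x).symm
  have key (t : X ⊗[k] HDual k H) :
      f.toLinearMap.rTensor (Hᵐᵒᵖ ⊗[k] HDual k H)
        (Algebra.TensorProduct.assoc k k k X Hᵐᵒᵖ (HDual k H)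
          (Algebra.TensorProduct.map α (AlgHom.id k (HDual k H)) t)) =
      Algebra.TensorProduct.assoc k k k Y Hᵐᵒᵖ (HDual k H)
        (Algebra.TensorProduct.map α' (AlgHom.id k (HDual k H))
          (f.toLinearMap.rTensor (HDual k H) t)) := by
    induction t with
    | zero => simp
    | add s t hs ht => simp only [map_add, hs, ht]
    | tmul y ω =>
      have hα' : α' (f y) = f.toLinearMap.rTensor Hᵐᵒᵖ (α y) := (LinearMap.congr_fun hα y).symm
      simp only [LinearMap.rTensor_tmul, AlgHom.toLinearMap_apply, Algebra.TensorProduct.map_tmul,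
        hα']
      generalize α y = s
      induction s with
      | zero => simp
      | add s t hs ht => simp only [map_add, TensorProduct.add_tmul, hs, ht]
      | tmul z a => simp
  exact (key (β x)).trans (congrArg (fun t => Algebra.TensorProduct.assoc k k k Y Hᵐᵒᵖ (HDual k H)
    (Algebra.TensorProduct.map α' (AlgHom.id k (HDual k H)) t)) hβ'.symm)

/-- `E_R : (X, ▷, δ) ↦ (X, ·)` with `(ω ⋈ h) · x = (id ⊗ p(·, ω)) (δ (h ▷ x))`. -/
def functorER [FiniteDimensional k H]
    (wd : ∀ X : LeftRightYD.{u, v, w} k H,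
      IsLeftModuleAlgebra k (Double k H) (radfordAction k H X.act X.coact)) :
    LeftRightYD.{u, v, w} k H ⥤ LeftModuleAlg.{u, max u v, w} k (Double k H) where
  obj X := ⟨X.carrier, radfordAction k H X.act X.coact, wd X⟩
  map f := ⟨f.hom, radfordAction_comm f.hom f.comm_act f.comm_coact⟩

variable [FiniteDimensional k H]

/-- `E'_R : (X, α, β) ↦ (X, γ = (α ⊗ id) β)`. -/
def functorER'
    (wd : ∀ X : RightRightYD.{u, v, w} k H, IsRightCoaction k (Codouble k H) (gamma k H X.α X.β)) :
    RightRightYD.{u, v, w} k H ⥤ RightComoduleAlg.{u, max u v, w} k (Codouble k H) where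
  obj X := ⟨X.carrier, gamma k H X.α X.β, wd X⟩
  map f := ⟨f.hom, gamma_comm f.hom f.comm_α f.comm_β⟩

/-- `(X, α, β) ↦ (X, ▷_β, α)`. -/
def functorBeta
    (wd : ∀ X : RightRightYD.{u, v, w} k H, IsLeftRightYD k H (actionOfBeta k H X.β) X.α) :
    RightRightYD.{u, v, w} k H ⥤ LeftRightYD.{u, v, w} k H where
  obj X := ⟨X.carrier, actionOfBeta k H X.β, X.α, wd X⟩
  map f := ⟨f.hom, inducedAction_comm _ f.hom f.comm_β, f.comm_α⟩

/-- `(X, γ) ↦ (X, ▷_γ)`. -/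
def functorGamma
    (wd : ∀ X : RightComoduleAlg.{u, max u v, w} k (Codouble k H),
      IsLeftModuleAlgebra k (Double k H) (actionOfGamma k H X.coact)) :
    RightComoduleAlg.{u, max u v, w} k (Codouble k H) ⥤
      LeftModuleAlg.{u, max u v, w} k (Double k H) where
  obj X := ⟨X.carrier, actionOfGamma k H X.coact, wd X⟩
  map f := ⟨f.hom, inducedAction_comm _ f.hom f.comm⟩

end Functors

end RadfordYD

end

/-! The engine is duality. Let `p : D × C → k` be a perfect pairing of finite-dimensional spaces
that matches products and units with coproducts and counits (`IsDualPairing`). Slicing gives a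
bijection `X ⊗ C → Hom(D, X)` that carries the product to convolution. A coaction of `C` on `X` is
therefore the same thing as a module algebra structure over `D`, with the same morphisms
(`isRightCoaction_iff`, `exists_coaction`, `coact_comm`). Neither associativity of `D` nor
coassociativity of `C` is needed. This is applied to `H` with `Ĥ`, to `Ĥᶜᵒ` with `Hᵒᵖ`, and to the
double with the codouble.

That the last pair is dual (`isDualPairing_pairingDouble`) comes from a computation in a convolution
algebra. Slicing identifies `Hᵒᵖ ⊗ Ĥ` with `Hom(H, Hᵒᵖ)` and sends `°U` to `h ↦ hᵒᵖ`, whose inverse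
is `h ↦ S⁻¹(h)ᵒᵖ`. Conjugation by this element is adjoint to the exchange map of the double
(`apply_conj_convOp`, `tensorPairing_exchange`). Invertibility of `S` is used here; it is proved by
making the dual of `H` a Hopf module (`antipode_bijective`).

The Yetter-Drinfeld conditions are handled in `Hom(H, X ⊗ Hᵒᵖ)`. With `u(h) = 1 ⊗ hᵒᵖ`, all of them
express the single relation `actCoact * u = u * coactAct`. Solved for `coactAct` it is the
right-right condition (`rightRight_compat_iff`). Solved for `actCoact` it says how the action of `H`
moves past that of `Ĥ`, which is the multiplication rule of the double
(`leftRight_compat_iff_exchange`). Hence functors 2, 3 and 4 are equivalences.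

Finally, the two ways around the square produce the same action (`actionOfGamma_gamma`). This gives
commutativity, shows through duality that `γ` is a coaction, and yields the equivalence for functor
1 by two-out-of-three. -/

noncomputable section

namespace RadfordYD

/-! ### Slice maps, and coactions as actions of the dual. -/

section Duality

variable {k : Type u} [Field k]

section Linear

variable {A B A' B' X Y : Type*} [AddCommGroup A] [Module k A] [AddCommGroup B] [Module k B]
  [AddCommGroup A'] [Module k A'] [AddCommGroup B'] [Module k B']
  [AddCommGroup X] [Module k X] [AddCommGroup Y] [Module k Y]

/-- The slice map `t ↦ (b ↦ (id ⊗ p(b, ·)) t)` of a pairing `p : B × A → k`. -/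
def slice (p : B →ₗ[k] A →ₗ[k] k) : X ⊗[k] A →ₗ[k] B →ₗ[k] X :=
  LinearMap.mk₂ k (fun t b => TensorProduct.rid k X ((p b).lTensor X t))
    (fun t t' b => by simp) (fun c t b => by simp)
    (fun t b b' => by simp [LinearMap.lTensor_add]) (fun c t b => by simp [LinearMap.lTensor_smul])

@[simp]
lemma slice_tmul (p : B →ₗ[k] A →ₗ[k] k) (x : X) (a : A) (b : B) :
    slice p (x ⊗ₜ[k] a) b = p b a • x := by
  simp [slice]

/-- A perfect pairing identifies `A` with the dual of `B`, and `X ⊗ B* ≅ Hom(B, X)` since `B` is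
finite-dimensional. Consequently elements of `X ⊗ A` may be compared slice by slice. -/
lemma slice_bijective (p : B →ₗ[k] A →ₗ[k] k) [p.IsPerfPair] [FiniteDimensional k B] :
    Function.Bijective (slice (X := X) p) := by
  have h : slice (X := X) p = ((LinearEquiv.lTensor X p.flip.toPerfPair) ≪≫ₗ
      TensorProduct.comm k X (Module.Dual k B) ≪≫ₗ
      dualTensorHomEquiv k B X).toLinearMap := by
    refine TensorProduct.ext' fun x a => LinearMap.ext fun b => ?_
    simp
  rw [h]
  exact LinearEquiv.bijective _

lemma slice_rTensor (p : B →ₗ[k] A →ₗ[k] k) (f : X →ₗ[k] Y) (t : X ⊗[k] A) (b : B) :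
    slice p (f.rTensor A t) b = f (slice p t b) := by
  induction t with
  | zero => simp
  | add s t hs ht => simp [hs, ht]
  | tmul x a => simp

@[simp]
lemma tensorPairing_tmul (p : A →ₗ[k] A' →ₗ[k] k) (q : B →ₗ[k] B' →ₗ[k] k) (a : A) (b : B)
    (a' : A') (b' : B') :
    tensorPairing p q (a ⊗ₜ[k] b) (a' ⊗ₜ[k] b') = p a a' * q b b' := by
  simp [tensorPairing]

instance tensorPairing_isPerfPair (p : A →ₗ[k] A' →ₗ[k] k) (q : B →ₗ[k] B' →ₗ[k] k)
    [p.IsPerfPair] [q.IsPerfPair] [FiniteDimensional k A'] [FiniteDimensional k B'] :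
    (tensorPairing p q).IsPerfPair := by
  apply LinearMap.IsPerfPair.of_bijective
  have h : tensorPairing p q = (TensorProduct.congr p.toPerfPair q.toPerfPair ≪≫ₗ
      dualDistribEquiv k A' B').toLinearMap := by
    refine TensorProduct.ext' fun a b => TensorProduct.ext' fun a' b' => ?_
    simp [dualDistribEquiv, dualDistribEquivOfBasis]
  rw [h]
  exact LinearEquiv.bijective _

end Linear

section Coact

variable {C D : Type*} [Ring C] [Algebra k C] [AddCommGroup D] [Module k D]
  {X : Type*} [Ring X] [Algebra k X]

lemma inducedAction_slice (p : D →ₗ[k] C →ₗ[k] k) (δ : X →ₗ[k] X ⊗[k] C) (d : D) (x : X) :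
    inducedAction p δ d x = slice p (δ x) d := rfl

/-- For `t = δ x` this makes the iterated coaction correspond to the iterated action `d ▷ (d' ▷ x)`:
the outer leg of `C` is paired with the element that acts first. -/
lemma slice_coact_coact (p : D →ₗ[k] C →ₗ[k] k) (δ : X →ₗ[k] X ⊗[k] C) (t : X ⊗[k] C) (d d' : D) :
    slice (tensorPairing p p) (TensorProduct.assoc k X C C (δ.rTensor C t)) (d ⊗ₜ[k] d') =
      inducedAction p δ d (slice p t d') := by
  induction t with
  | zero => simp
  | add s t hs ht => simp only [map_add, LinearMap.add_apply, hs, ht]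
  | tmul x c =>
    simp only [LinearMap.rTensor_tmul, slice_tmul, map_smul, inducedAction_slice]
    generalize δ x = t
    induction t with
    | zero => simp
    | add s t hs ht =>
      simp only [map_add, LinearMap.add_apply, hs, ht, TensorProduct.add_tmul, smul_add]
    | tmul y c' => simp [smul_smul, mul_comm]

end Coact

/-- `p : D × C → k` is a perfect pairing that makes the multiplication and the comultiplication of
`D` dual to the comultiplication and the multiplication of `C`. -/
structure IsDualPairing {C D : Type*} [Ring C] [Algebra k C] [CoalgebraStruct k C]
    [AddCommGroup D] [Module k D] [Mul D] [One D] [CoalgebraStruct k D]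
    (p : D →ₗ[k] C →ₗ[k] k) : Prop where
  isPerfPair : p.IsPerfPair
  one_left : ∀ c : C, p 1 c = counit (R := k) c
  mul_left : ∀ (d d' : D) (c : C), p (d * d') c = tensorPairing p p (d ⊗ₜ[k] d') (comul (R := k) c)
  one_right : ∀ d : D, p d 1 = counit (R := k) d
  mul_right : ∀ (d : D) (c c' : C), p d (c * c') =
    tensorPairing p p (comul (R := k) d) (c ⊗ₜ[k] c')

namespace IsDualPairing

variable {C D : Type*} [Ring C] [Algebra k C] [CoalgebraStruct k C]
  [AddCommGroup D] [Module k D] [Mul D] [One D] [CoalgebraStruct k D]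
  {p : D →ₗ[k] C →ₗ[k] k} {X Y : Type*} [Ring X] [Algebra k X] [Ring Y] [Algebra k Y]

lemma slice_one (hp : IsDualPairing p) (d : D) :
    slice p (1 : X ⊗[k] C) d = counit (R := k) d • (1 : X) := by
  rw [Algebra.TensorProduct.one_def, slice_tmul, hp.one_right]

/-- Slicing is multiplicative from `X ⊗ C` to the convolution product on `Hom(D, X)`. It yields both
the module algebra law and the ring isomorphism `sliceEquiv`. -/
lemma slice_mul (hp : IsDualPairing p) (t t' : X ⊗[k] C) (d : D) :
    slice p (t * t') d =
      LinearMap.mul' k X (TensorProduct.map (slice p t) (slice p t') (comul (R := k) d)) := by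
  induction t with
  | zero => simp
  | add s t hs ht => simp [add_mul, hs, ht, TensorProduct.map_add_left]
  | tmul x c =>
    induction t' with
    | zero => simp
    | add s t hs ht => simp [mul_add, hs, ht, TensorProduct.map_add_right]
    | tmul y c' =>
      rw [Algebra.TensorProduct.tmul_mul_tmul, slice_tmul, hp.mul_right]
      generalize comul (R := k) d = z
      induction z with
      | zero => simp
      | add s t hs ht => simp [add_smul, hs, ht]
      | tmul d d' => simp [smul_smul, mul_comm]

lemma slice_lTensor_comul (hp : IsDualPairing p) (t : X ⊗[k] C) (d d' : D) :
    slice (tensorPairing p p) ((comul (R := k) (A := C)).lTensor X t) (d ⊗ₜ[k] d') =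
      slice p t (d * d') := by
  induction t with
  | zero => simp
  | add s t hs ht => simp only [map_add, LinearMap.add_apply, hs, ht]
  | tmul x c => simp [hp.mul_left]

lemma slice_one_right (hp : IsDualPairing p) (t : X ⊗[k] C) :
    slice p t 1 = TensorProduct.rid k X ((counit (R := k) (A := C)).lTensor X t) := by
  induction t with
  | zero => simp
  | add s t hs ht => simp only [map_add, LinearMap.add_apply, hs, ht]
  | tmul x c => simp [hp.one_left]

/-- Right coactions of `C` correspond to module algebra structures over its dual. -/
lemma isRightCoaction_iff (hp : IsDualPairing p) [FiniteDimensional k C] [FiniteDimensional k D]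
    (δ : X →ₐ[k] X ⊗[k] C) :
    IsRightCoaction k C δ ↔ IsLeftModuleAlgebra k D (inducedAction p δ.toLinearMap) := by
  have := hp.isPerfPair
  constructor
  · intro h
    refine ⟨fun x => ?_, fun d d' x => ?_, fun d x y => ?_, fun d => ?_⟩
    · rw [inducedAction_slice, hp.slice_one_right]
      exact LinearMap.congr_fun h.counit_id x
    · rw [inducedAction_slice, ← hp.slice_lTensor_comul, inducedAction_slice p _ d',
        ← slice_coact_coact]
      exact congrArg (fun t => slice (tensorPairing p p) t (d ⊗ₜ[k] d'))
        (LinearMap.congr_fun h.coassoc x).symm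
    · rw [inducedAction_slice, AlgHom.toLinearMap_apply, map_mul, hp.slice_mul]
      rfl
    · rw [inducedAction_slice, AlgHom.toLinearMap_apply, map_one, hp.slice_one]
  · intro h
    refine ⟨LinearMap.ext fun x => ?_, LinearMap.ext fun x => ?_⟩
    · apply (slice_bijective (tensorPairing p p)).injective
      refine TensorProduct.ext' fun d d' => ?_
      simp only [LinearMap.comp_apply, LinearEquiv.coe_coe]
      rw [slice_coact_coact, hp.slice_lTensor_comul, ← inducedAction_slice, ← inducedAction_slice,
        h.mul_act]
    · simp only [LinearMap.comp_apply, LinearEquiv.coe_coe]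
      rw [← hp.slice_one_right, ← inducedAction_slice, h.one_act]
      rfl

/-- Every module algebra structure over the dual of `C` is induced by a coaction of `C`. -/
lemma exists_coaction (hp : IsDualPairing p) [FiniteDimensional k C] [FiniteDimensional k D]
    {act : D →ₗ[k] X →ₗ[k] X} (h : IsLeftModuleAlgebra k D act) :
    ∃ δ : X →ₐ[k] X ⊗[k] C, IsRightCoaction k C δ ∧ inducedAction p δ.toLinearMap = act := by
  have := hp.isPerfPair
  -- The coaction is forced: `δ x` has to be the unique element whose slices are `d ↦ d ▷ x`. That
  -- `δ` is unital and multiplicative is then read off from the slices.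
  let e := LinearEquiv.ofBijective _ (slice_bijective (X := X) p)
  have he (x : X) : slice p (e.symm (act.flip x)) = act.flip x := e.apply_symm_apply _
  let δ : X →ₐ[k] X ⊗[k] C := AlgHom.ofLinearMap (e.symm.toLinearMap ∘ₗ act.flip)
    (by
      apply e.injective
      refine LinearMap.ext fun d => ?_
      change slice p (e.symm (act.flip 1)) d = slice p 1 d
      rw [he, hp.slice_one]
      exact h.act_one d)
    (fun x y => by
      apply e.injective
      refine LinearMap.ext fun d => ?_
      change slice p (e.symm (act.flip (x * y))) d =
        slice p (e.symm (act.flip x) * e.symm (act.flip y)) d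
      rw [hp.slice_mul, he, he, he]
      exact h.act_mul d x y)
  have hδ : inducedAction p δ.toLinearMap = act := by
    refine LinearMap.ext fun d => LinearMap.ext fun x => ?_
    exact LinearMap.congr_fun (he x) d
  refine ⟨δ, ?_, hδ⟩
  rw [hp.isRightCoaction_iff, hδ]
  exact h

lemma coact_comm (hp : IsDualPairing p) [FiniteDimensional k D]
    {δ : X →ₐ[k] X ⊗[k] C} {δ' : Y →ₐ[k] Y ⊗[k] C} (f : X →ₐ[k] Y)
    (h : ∀ (d : D) (x : X), f (inducedAction p δ.toLinearMap d x) =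
      inducedAction p δ'.toLinearMap d (f x)) :
    f.toLinearMap.rTensor C ∘ₗ δ.toLinearMap = δ'.toLinearMap ∘ₗ f.toLinearMap := by
  have := hp.isPerfPair
  refine LinearMap.ext fun x => (slice_bijective p).injective (LinearMap.ext fun d => ?_)
  rw [LinearMap.comp_apply, slice_rTensor]
  exact h d x

end IsDualPairing

end Duality

/-! ### The antipode of a finite-dimensional Hopf algebra is bijective -/

section Antipode

open HopfAlgebra WithConv

variable {k : Type u} {H : Type v} [Field k] [Ring H] [HopfAlgebra k H]

/-- The convolution unit laws of the antipode, transported along an algebra homomorphism. -/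
lemma algHom_antipode_mul_algHom {R : Type*} [Ring R] [Algebra k R] (j : H →ₐ[k] R) :
    toConv (j.toLinearMap ∘ₗ antipode k) * toConv j.toLinearMap =
      (1 : WithConv (H →ₗ[k] R)) := by
  have h := LinearMap.algHom_comp_convMul_distrib j (toConv (antipode k (A := H)))
    (toConv LinearMap.id)
  rw [LinearMap.antipode_mul_id] at h
  apply ofConv_injective
  refine Eq.trans h.symm ?_
  ext x
  simp

lemma algHom_mul_algHom_antipode {R : Type*} [Ring R] [Algebra k R] (j : H →ₐ[k] R) :
    toConv j.toLinearMap * toConv (j.toLinearMap ∘ₗ antipode k) =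
      (1 : WithConv (H →ₗ[k] R)) := by
  have h := LinearMap.algHom_comp_convMul_distrib j (toConv LinearMap.id)
    (toConv (antipode k (A := H)))
  rw [LinearMap.id_mul_antipode] at h
  apply ofConv_injective
  refine Eq.trans h.symm ?_
  ext x
  simp

variable (k H) in
/-- The left factor `h ↦ h ⊗ 1`. -/
abbrev inclLeft : H →ₐ[k] H ⊗[k] H := Algebra.TensorProduct.includeLeft

variable (k H) in
/-- The right factor `h ↦ 1 ⊗ h`. -/
abbrev inclRight : H →ₐ[k] H ⊗[k] H := Algebra.TensorProduct.includeRight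

/-- The factorization `Δ(h) = (h₁ ⊗ 1)(1 ⊗ h₂)` reduces the identities for `Δ ∘ S` below to
group-like cancellation in the convolution algebra `Hom(H, H ⊗ H)`. -/
lemma comul_eq_inclLeft_mul_inclRight :
    toConv (comul (R := k) (A := H)) =
      toConv (inclLeft k H).toLinearMap * toConv (inclRight k H).toLinearMap := by
  apply ofConv_injective
  ext h
  rw [LinearMap.convMul_def]
  simp only [LinearMap.comp_apply]
  generalize comul (R := k) h = z
  induction z with
  | zero => simp
  | add s t hs ht => rw [map_add, map_add, ← hs, ← ht]
  | tmul a b => simp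

/-- `Δ(S(h)) = S(h₂) ⊗ S(h₁)`. -/
lemma comul_antipode :
    toConv (comul (R := k) (A := H) ∘ₗ antipode k) =
      toConv ((inclRight k H).toLinearMap ∘ₗ antipode k) *
        toConv ((inclLeft k H).toLinearMap ∘ₗ antipode k) := by
  -- Both sides are convolution inverses of `Δ`, hence equal.
  refine (left_inv_eq_right_inv (a := toConv (comul (R := k) (A := H))) ?_
    LinearMap.comul_right_inv).symm
  rw [comul_eq_inclLeft_mul_inclRight, mul_assoc,
    ← mul_assoc (toConv ((inclLeft k H).toLinearMap ∘ₗ antipode k)), algHom_antipode_mul_algHom,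
    one_mul, algHom_antipode_mul_algHom]

/-- `S(h₁)₁ h₂ ⊗ S(h₁)₂ = 1 ⊗ S(h)`. -/
lemma comul_antipode_mul_inclLeft :
    toConv (comul (R := k) (A := H) ∘ₗ antipode k) * toConv (inclLeft k H).toLinearMap =
      toConv ((inclRight k H).toLinearMap ∘ₗ antipode k) := by
  rw [comul_antipode, mul_assoc, algHom_antipode_mul_algHom, mul_one]

/-- `S(h₂)₁ ⊗ h₁ S(h₂)₂ = S(h) ⊗ 1`. -/
lemma inclRight_mul_comul_antipode :
    toConv (inclRight k H).toLinearMap * toConv (comul (R := k) (A := H) ∘ₗ antipode k) =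
      toConv ((inclLeft k H).toLinearMap ∘ₗ antipode k) := by
  rw [comul_antipode, ← mul_assoc, algHom_mul_algHom_antipode, one_mul]

/-! ### The dual of `H` as a right Hopf module. -/

variable (k H) in
/-- The right action `(m · h)(x) = m (x S(h))` of `H` on its dual. -/
def dualAct : Module.Dual k H ⊗[k] H →ₗ[k] Module.Dual k H :=
  TensorProduct.lift <| LinearMap.mk₂ k (fun m h => m ∘ₗ LinearMap.mulRight k (antipode k h))
    (fun _ _ _ => rfl) (fun _ _ _ => rfl)
    (fun _ _ _ => by ext; simp [mul_add]) (fun _ _ _ => by ext; simp)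

@[simp]
lemma dualAct_tmul (m : Module.Dual k H) (h x : H) :
    dualAct k H (m ⊗ₜ[k] h) x = m (x * antipode k h) := rfl

lemma dualAct_one (m : Module.Dual k H) : dualAct k H (m ⊗ₜ[k] 1) = m := by
  ext x; simp

lemma dualAct_dualAct (m : Module.Dual k H) (g h : H) :
    dualAct k H (dualAct k H (m ⊗ₜ[k] g) ⊗ₜ[k] h) = dualAct k H (m ⊗ₜ[k] (g * h)) := by
  ext x; simp [antipode_mul_antidistrib, mul_assoc]

variable [FiniteDimensional k H]

variable (k H) in
/-- The right coaction `m ↦ m₀ ⊗ m₁` of `H` on its dual with `m₀(x) m₁ = x₁ m(x₂)`. -/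
def dualCoact : Module.Dual k H →ₗ[k] Module.Dual k H ⊗[k] H :=
  (dualTensorHomEquiv k H H).symm.toLinearMap ∘ₗ
    LinearMap.mk₂ k (fun m x => TensorProduct.rid k H (m.lTensor H (comul (R := k) x)))
    (fun _ _ _ => by simp [LinearMap.lTensor_add]) (fun _ _ _ => by simp [LinearMap.lTensor_smul])
    (fun _ _ _ => by simp) (fun _ _ _ => by simp)

lemma dualTensorHom_dualCoact (m : Module.Dual k H) (x : H) :
    dualTensorHom k H H (dualCoact k H m) x =
      TensorProduct.rid k H (m.lTensor H (comul (R := k) x)) := by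
  have h := (dualTensorHomEquiv k H H).apply_symm_apply
    (LinearMap.mk₂ k (fun m x => TensorProduct.rid k H (m.lTensor H (comul (R := k) x)))
    (fun _ _ _ => by simp [LinearMap.lTensor_add]) (fun _ _ _ => by simp [LinearMap.lTensor_smul])
    (fun _ _ _ => by simp) (fun _ _ _ => by simp) m)
  exact LinearMap.congr_fun h x

lemma dualTensorHom_injective : Function.Injective (dualTensorHom k H H) :=
  (dualTensorHomEquiv k H H).injective


/-- The coaction is characterized by its values `x₁ m(x₂)`, so identities about it are tested by
evaluating the leg in the dual at `x`. In that form coassociativity of the coaction becomes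
coassociativity of `Δ`. -/
lemma dualTensorHom_rTensor_dualCoact (t : Module.Dual k H ⊗[k] H) (x : H) :
    dualTensorHom k H (H ⊗[k] H)
        (TensorProduct.assoc k _ _ _ ((dualCoact k H).rTensor H t)) x =
      (dualTensorHom k H H t).lTensor H (comul (R := k) x) := by
  induction t with
  | zero => simp
  | add s t hs ht => simp only [map_add, LinearMap.add_apply, hs, ht, LinearMap.lTensor_add]
  | tmul m h =>
    have h1 (w : Module.Dual k H ⊗[k] H) : dualTensorHom k H (H ⊗[k] H)
        (TensorProduct.assoc k _ _ _ (w ⊗ₜ[k] h)) x = dualTensorHom k H H w x ⊗ₜ[k] h := by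
      induction w with
      | zero => simp
      | add s t hs ht =>
        simp only [map_add, LinearMap.add_apply, hs, ht, TensorProduct.add_tmul]
      | tmul n g => simp [TensorProduct.smul_tmul']
    rw [LinearMap.rTensor_tmul, h1, dualTensorHom_dualCoact]
    generalize comul (R := k) x = z
    induction z with
    | zero => simp
    | add s t hs ht => simp only [map_add, TensorProduct.add_tmul, hs, ht]
    | tmul a b => simp [TensorProduct.smul_tmul]

lemma dualCoact_coassoc (m : Module.Dual k H) :
    TensorProduct.assoc k _ _ _ ((dualCoact k H).rTensor H (dualCoact k H m)) =
      (comul (R := k) (A := H)).lTensor _ (dualCoact k H m) := by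
  apply (dualTensorHomEquiv k H (H ⊗[k] H)).injective
  refine LinearMap.ext fun x => ?_
  change dualTensorHom k H (H ⊗[k] H) _ x = dualTensorHom k H (H ⊗[k] H) _ x
  rw [dualTensorHom_rTensor_dualCoact]
  have h1 (t : Module.Dual k H ⊗[k] H) : dualTensorHom k H (H ⊗[k] H)
      ((comul (R := k) (A := H)).lTensor _ t) x = comul (R := k) (dualTensorHom k H H t x) := by
    induction t with
    | zero => simp
    | add s t hs ht => simp only [map_add, LinearMap.add_apply, hs, ht]
    | tmul n g => simp
  have h2 (z : H ⊗[k] H) : comul (R := k) (TensorProduct.rid k H (m.lTensor H z)) =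
      ((TensorProduct.rid k H).toLinearMap ∘ₗ m.lTensor H).lTensor H
        (TensorProduct.assoc k _ _ _ ((comul (R := k) (A := H)).rTensor H z)) := by
    induction z with
    | zero => simp
    | add s t hs ht => simp only [map_add, hs, ht]
    | tmul a b =>
      simp only [LinearMap.lTensor_tmul, LinearMap.rTensor_tmul, TensorProduct.rid_tmul, map_smul]
      generalize comul (R := k) a = w
      induction w with
      | zero => simp
      | add s t hs ht => simp only [map_add, smul_add, TensorProduct.add_tmul, hs, ht]
      | tmul c d => simp
  have h3 : dualTensorHom k H H (dualCoact k H m) =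
      ((TensorProduct.rid k H).toLinearMap ∘ₗ m.lTensor H) ∘ₗ comul (R := k) (A := H) :=
    LinearMap.ext fun x => dualTensorHom_dualCoact m x
  rw [h1, dualTensorHom_dualCoact, h2, coassoc_apply, h3]
  rw [LinearMap.lTensor_comp_apply]

lemma dualCoact_counit (m : Module.Dual k H) :
    TensorProduct.rid k _ ((counit (R := k) (A := H)).lTensor _ (dualCoact k H m)) = m := by
  refine LinearMap.ext fun x => ?_
  have h1 (t : Module.Dual k H ⊗[k] H) :
      TensorProduct.rid k _ ((counit (R := k) (A := H)).lTensor _ t) x =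
        counit (R := k) (dualTensorHom k H H t x) := by
    induction t with
    | zero => simp
    | add s t hs ht => simp only [map_add, LinearMap.add_apply, hs, ht]
    | tmul n g => simp [mul_comm]
  have h2 (z : H ⊗[k] H) : counit (R := k) (TensorProduct.rid k H (m.lTensor H z)) =
      m (TensorProduct.lid k H ((counit (R := k) (A := H)).rTensor H z)) := by
    induction z with
    | zero => simp
    | add s t hs ht => simp only [map_add, hs, ht]
    | tmul a b => simp [mul_comm]
  rw [h1, dualTensorHom_dualCoact, h2, rTensor_counit_comul]
  simp

/-- `ρ(m · h) = m₀ · h₁ ⊗ m₁ h₂`. -/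
lemma dualCoact_dualAct (m : Module.Dual k H) (h : H) :
    dualCoact k H (dualAct k H (m ⊗ₜ[k] h)) =
      TensorProduct.map (dualAct k H) (LinearMap.mul' k H)
        (TensorProduct.tensorTensorTensorComm k _ _ _ _
          (dualCoact k H m ⊗ₜ[k] comul (R := k) h)) := by
  apply dualTensorHom_injective
  refine LinearMap.ext fun x => ?_
  rw [dualTensorHom_dualCoact]
  have h1 (t : Module.Dual k H ⊗[k] H) (a b : H) : dualTensorHom k H H
      (TensorProduct.map (dualAct k H) (LinearMap.mul' k H)
        (TensorProduct.tensorTensorTensorComm k _ _ _ _ (t ⊗ₜ[k] (a ⊗ₜ[k] b)))) x =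
      dualTensorHom k H H t (x * antipode k a) * b := by
    induction t with
    | zero => simp
    | add s t hs ht =>
      simp only [map_add, LinearMap.add_apply, hs, ht, TensorProduct.add_tmul, add_mul]
    | tmul n g => simp
  have h2 (z : H ⊗[k] H) (b : H) : TensorProduct.rid k H (m.lTensor H (z * b ⊗ₜ[k] 1)) =
      TensorProduct.rid k H (m.lTensor H z) * b := by
    induction z with
    | zero => simp
    | add s t hs ht => simp only [map_add, add_mul, hs, ht]
    | tmul c d => simp
  have h3 (z : H ⊗[k] H) : dualTensorHom k H H
      (TensorProduct.map (dualAct k H) (LinearMap.mul' k H)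
        (TensorProduct.tensorTensorTensorComm k _ _ _ _ (dualCoact k H m ⊗ₜ[k] z))) x =
      TensorProduct.rid k H (m.lTensor H (comul (R := k) x *
        LinearMap.mul' k _ (TensorProduct.map (comul (R := k) (A := H) ∘ₗ antipode k)
          (inclLeft k H).toLinearMap z))) := by
    induction z with
    | zero => simp
    | add s t hs ht =>
      simp only [map_add, LinearMap.add_apply, hs, ht, TensorProduct.tmul_add, mul_add]
    | tmul a b =>
      rw [h1, dualTensorHom_dualCoact, ← h2, Bialgebra.comul_mul, mul_assoc]
      rfl
  -- After evaluation at `x`, the right side is `m` applied to the second leg of `Δ(x) Δ(S(h₁)) (h₂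
  -- ⊗ 1)`. This identity collapses the last two factors to `1 ⊗ S(h)`, which leaves `x₁ m(x₂
  -- S(h))`.
  have h4 : LinearMap.mul' k _ (TensorProduct.map (comul (R := k) (A := H) ∘ₗ antipode k)
      (inclLeft k H).toLinearMap (comul (R := k) h)) = 1 ⊗ₜ[k] antipode k h :=
    congr($comul_antipode_mul_inclLeft h)
  rw [h3, h4]
  generalize comul (R := k) x = z
  induction z with
  | zero => simp
  | add s t hs ht => simp only [map_add, add_mul, hs, ht]
  | tmul c d => simp

variable (k H) in
/-- The projection `m ↦ m₀ · S(m₁)` onto the coinvariants of the dual of `H`. -/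
def dualProj : Module.Dual k H →ₗ[k] Module.Dual k H :=
  dualAct k H ∘ₗ (antipode k).lTensor _ ∘ₗ dualCoact k H

/-- By Hopf module compatibility and coassociativity, `ρ(m₀ · S(m₁)) = m₀ · S(m₂)₁ ⊗ m₁ S(m₂)₂`. The
identity `inclRight_mul_comul_antipode` turns this into `m₀ · S(m₁) ⊗ 1`. -/
lemma dualCoact_dualProj (m : Module.Dual k H) :
    dualCoact k H (dualProj k H m) = dualProj k H m ⊗ₜ[k] 1 := by
  let G : (Module.Dual k H ⊗[k] H) ⊗[k] H →ₗ[k] Module.Dual k H ⊗[k] H :=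
    TensorProduct.map (dualAct k H) (LinearMap.mul' k H) ∘ₗ
      (TensorProduct.tensorTensorTensorComm k _ _ _ _).toLinearMap ∘ₗ
      (comul (R := k) (A := H) ∘ₗ antipode k).lTensor _
  have h1 (t : Module.Dual k H ⊗[k] H) : dualCoact k H (dualAct k H ((antipode k).lTensor _ t)) =
      G ((dualCoact k H).rTensor H t) := by
    induction t with
    | zero => simp
    | add s t hs ht => simp only [map_add, hs, ht]
    | tmul n h => simp [G, dualCoact_dualAct]
  have h2 (n : Module.Dual k H) (z : H ⊗[k] H) :
      G ((TensorProduct.assoc k _ _ _).symm (n ⊗ₜ[k] z)) =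
        (dualAct k H ∘ₗ TensorProduct.mk k _ H n).rTensor H (LinearMap.mul' k _
          (TensorProduct.map (inclRight k H).toLinearMap (comul (R := k) (A := H) ∘ₗ antipode k) z)) := by
    induction z with
    | zero => simp
    | add s t hs ht => simp only [map_add, TensorProduct.tmul_add, hs, ht]
    | tmul a b =>
      simp only [G, TensorProduct.assoc_symm_tmul, LinearMap.comp_apply, LinearMap.lTensor_tmul,
        LinearEquiv.coe_coe, TensorProduct.map_tmul, LinearMap.mul'_apply]
      generalize comul (R := k) (antipode k b) = w
      induction w with
      | zero => simp
      | add s t hs ht => simp only [map_add, TensorProduct.tmul_add, mul_add, hs, ht]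
      | tmul c d => simp
  have h3 (t : Module.Dual k H ⊗[k] H) :
      G ((TensorProduct.assoc k _ _ _).symm ((comul (R := k) (A := H)).lTensor _ t)) =
        dualAct k H ((antipode k).lTensor _ t) ⊗ₜ[k] 1 := by
    induction t with
    | zero => simp
    | add s t hs ht => simp only [map_add, TensorProduct.add_tmul, hs, ht]
    | tmul n h =>
      have h4 : LinearMap.mul' k _ (TensorProduct.map (inclRight k H).toLinearMap
          (comul (R := k) (A := H) ∘ₗ antipode k) (comul (R := k) h)) = antipode k h ⊗ₜ[k] 1 :=
        congr($inclRight_mul_comul_antipode h)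
      rw [LinearMap.lTensor_tmul, h2, h4]
      simp
  rw [dualProj, LinearMap.comp_apply, LinearMap.comp_apply, h1, ← h3, ← dualCoact_coassoc,
    LinearEquiv.symm_apply_apply]

/-- `m = P(m₀) · m₁` for the projection `P` onto the coinvariants. -/
lemma dualAct_dualProj_dualCoact (m : Module.Dual k H) :
    dualAct k H ((dualProj k H).rTensor H (dualCoact k H m)) = m := by
  -- `K` is `(n ⊗ a) ⊗ b ↦ (n · S(a)) · b`. By coassociativity the left side is `m₀ · (S(m₁) m₂)`,
  -- and the antipode law leaves `m₀ ε(m₁) = m`.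
  let K : (Module.Dual k H ⊗[k] H) ⊗[k] H →ₗ[k] Module.Dual k H :=
    dualAct k H ∘ₗ (dualAct k H ∘ₗ (antipode k).lTensor _).rTensor H
  have h1 (n : Module.Dual k H) (z : H ⊗[k] H) :
      K ((TensorProduct.assoc k _ _ _).symm (n ⊗ₜ[k] z)) =
        dualAct k H (n ⊗ₜ[k] LinearMap.mul' k H ((antipode k).rTensor H z)) := by
    induction z with
    | zero => simp
    | add s t hs ht => simp only [map_add, TensorProduct.tmul_add, hs, ht]
    | tmul a b => simp [K, dualAct_dualAct]
  have h2 (t : Module.Dual k H ⊗[k] H) :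
      K ((TensorProduct.assoc k _ _ _).symm ((comul (R := k) (A := H)).lTensor _ t)) =
        TensorProduct.rid k _ ((counit (R := k) (A := H)).lTensor _ t) := by
    induction t with
    | zero => simp
    | add s t hs ht => simp only [map_add, hs, ht]
    | tmul n h =>
      rw [LinearMap.lTensor_tmul, h1, mul_antipode_rTensor_comul_apply,
        Algebra.algebraMap_eq_smul_one, TensorProduct.tmul_smul, map_smul, dualAct_one]
      simp
  have h3 : (dualProj k H).rTensor H (dualCoact k H m) =
      (dualAct k H ∘ₗ (antipode k).lTensor _).rTensor H
        ((dualCoact k H).rTensor H (dualCoact k H m)) := by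
    rw [← LinearMap.rTensor_comp_apply]
    rfl
  rw [h3]
  change K _ = m
  rw [← (TensorProduct.assoc k _ _ _).symm_apply_apply ((dualCoact k H).rTensor H _),
    dualCoact_coassoc, h2, dualCoact_counit]

/-- For coinvariant `m` one has `ρ(m · h) = m · h₁ ⊗ h₂`. The map `E : n ⊗ g ↦ n · S(g₁) ⊗ g₂` sends
this to `m · (h₁ S(h₂)) ⊗ h₃ = m ⊗ h`, so `m ⊗ h` is recovered from `m · h`. -/
lemma tmul_eq_zero_of_dualAct_eq_zero {m : Module.Dual k H} (hm : dualCoact k H m = m ⊗ₜ[k] 1)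
    {h : H} (hh : dualAct k H (m ⊗ₜ[k] h) = 0) : m ⊗ₜ[k] h = 0 := by
  let E : Module.Dual k H ⊗[k] H →ₗ[k] Module.Dual k H ⊗[k] H :=
    (dualAct k H).rTensor H ∘ₗ (TensorProduct.assoc k _ _ _).symm.toLinearMap ∘ₗ
      ((antipode k).rTensor H ∘ₗ comul (R := k) (A := H)).lTensor _
  have h1 (z : H ⊗[k] H) : TensorProduct.map (dualAct k H) (LinearMap.mul' k H)
      (TensorProduct.tensorTensorTensorComm k _ _ _ _ ((m ⊗ₜ[k] (1 : H)) ⊗ₜ[k] z)) =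
        (dualAct k H ∘ₗ TensorProduct.mk k _ H m).rTensor H z := by
    induction z with
    | zero => simp
    | add s t hs ht => simp only [map_add, TensorProduct.tmul_add, hs, ht]
    | tmul a b => simp
  have h2 (z : H ⊗[k] H) : E ((dualAct k H ∘ₗ TensorProduct.mk k _ H m).rTensor H z) =
      (dualAct k H ∘ₗ TensorProduct.mk k _ H m).rTensor H
        ((LinearMap.mul' k H ∘ₗ (antipode k).lTensor H).rTensor H
          ((TensorProduct.assoc k _ _ _).symm ((comul (R := k) (A := H)).lTensor H z))) := by
    induction z with
    | zero => simp
    | add s t hs ht => simp only [map_add, hs, ht]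
    | tmul a b =>
      simp only [E, LinearMap.rTensor_tmul, LinearMap.comp_apply, LinearMap.lTensor_tmul]
      generalize comul (R := k) b = w
      induction w with
      | zero => simp
      | add s t hs ht => simp only [map_add, TensorProduct.tmul_add, hs, ht]
      | tmul c d => simp [dualAct_dualAct]
  have h3 := congrArg (dualCoact k H) hh
  rw [dualCoact_dualAct, hm, h1, map_zero] at h3
  have h4 := h2 (comul (R := k) h)
  have h5 : (LinearMap.mul' k H ∘ₗ (antipode k).lTensor H) ∘ₗ comul (R := k) (A := H) =
      Algebra.linearMap k H ∘ₗ counit := mul_antipode_lTensor_comul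
  have h6 : (LinearMap.mul' k H ∘ₗ (antipode k).lTensor H).rTensor H
      ((comul (R := k) (A := H)).rTensor H (comul (R := k) h)) = 1 ⊗ₜ[k] h := by
    rw [← LinearMap.rTensor_comp_apply, h5, LinearMap.rTensor_comp_apply, rTensor_counit_comul]
    simp
  rw [h3, map_zero, coassoc_symm_apply, h6] at h4
  simpa [dualAct_one] using h4.symm

variable (k H) in
/-- The antipode of a finite-dimensional Hopf algebra is bijective. -/
theorem antipode_bijective : Function.Bijective (antipode k : H →ₗ[k] H) := by
  have hinj : Function.Injective (antipode k : H →ₗ[k] H) := by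
    rw [injective_iff_map_eq_zero]
    intro h hh
    -- The action is defined through `S`, so an element `h` of its kernel acts by zero. If `h ≠ 0`,
    -- every coinvariant then vanishes, so `P = 0`. The identity `m = P(m₀) · m₁` makes the whole
    -- dual zero, which is impossible.
    have hact (m : Module.Dual k H) : dualAct k H (m ⊗ₜ[k] h) = 0 := by
      ext x; simp [hh]
    by_contra hne
    have hproj (m : Module.Dual k H) : dualProj k H m = 0 := by
      have h1 := tmul_eq_zero_of_dualAct_eq_zero (dualCoact_dualProj m) (hact _)
      refine LinearMap.ext fun x => ?_
      have h2 := congr(dualTensorHom k H H $h1 x)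
      simpa [hne] using h2
    have hzero (m : Module.Dual k H) : m = 0 := by
      rw [← dualAct_dualProj_dualCoact m, show dualProj k H = 0 from LinearMap.ext hproj]
      simp
    refine hne ((Module.forall_dual_apply_eq_zero_iff k h).1 fun m => ?_)
    rw [hzero m, LinearMap.zero_apply]
  exact ⟨hinj, LinearMap.injective_iff_surjective.1 hinj⟩

end Antipode

section DualPairings

open HopfAlgebra WithConv MulOpposite

variable (k : Type u) (H : Type v) [Field k] [Ring H] [HopfAlgebra k H]

/-! ### Dual pairings -/

variable {k H} in
@[simp]
lemma pairing_toHDual (h : H) (f : Module.Dual k H) : pairing k H h (toHDual k H f) = f h := rfl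

variable {k H} in
@[simp]
lemma pairingOp_op (ω : HDual k H) (c : H) : pairingOp k H ω (op c) = pairing k H c ω := rfl

variable {k H} in
-- Adjointness of the regular actions to multiplication; it moves the outer factors of a conjugation
-- onto `θ`.
lemma pairing_regular (θ : HDual k H) (a b c : H) :
    pairing k H c (regularRight k H (regularLeft k H a θ) b) = pairing k H (b * c * a) θ := rfl

section FiniteDimensional

variable [FiniteDimensional k H]

instance : FiniteDimensional k (HDual k H) := (toHDual k H).finiteDimensional

instance : FiniteDimensional k Hᵐᵒᵖ := (opLinearEquiv k (M := H)).finiteDimensional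

instance : FiniteDimensional k (Double k H) :=
  inferInstanceAs (FiniteDimensional k (HDual k H ⊗[k] H))

instance : FiniteDimensional k (Codouble k H) :=
  inferInstanceAs (FiniteDimensional k (Hᵐᵒᵖ ⊗[k] HDual k H))

instance pairing_isPerfPair : (pairing k H).IsPerfPair :=
  (LinearMap.IsPerfPair.of_bijective (toHDual k H).symm.toLinearMap (toHDual k H).symm.bijective).flip

instance pairingOp_isPerfPair : (pairingOp k H).IsPerfPair :=
  inferInstanceAs ((pairing k H).flip.compl₁₂ (LinearEquiv.refl k (HDual k H)).toLinearMap
    (opLinearEquiv k (M := H)).symm.toLinearMap).IsPerfPair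

instance pairingDouble_isPerfPair : (pairingDouble k H).IsPerfPair :=
  tensorPairing_isPerfPair (pairingOp k H) (pairing k H)

/-- The canonical pairing of `H` with its dual. -/
lemma isDualPairing_pairing : IsDualPairing (pairing k H) where
  isPerfPair := inferInstance
  one_left _ := rfl
  mul_left d d' c := by
    have h (w : Module.Dual k H ⊗[k] Module.Dual k H) :
        tensorPairing (pairing k H) (pairing k H) (d ⊗ₜ[k] d')
          (TensorProduct.map (toHDual k H).toLinearMap (toHDual k H).toLinearMap w) =
        dualDistribEquiv k H H w (d ⊗ₜ[k] d') := by
      induction w with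
      | zero => simp
      | add s t hs ht => simp only [map_add, LinearMap.add_apply, hs, ht]
      | tmul f g => simp [dualDistribEquiv, dualDistribEquivOfBasis]
    refine Eq.trans ?_ (h ((dualDistribEquiv k H H).symm
      ((LinearMap.mul' k H).dualMap ((toHDual k H).symm c)))).symm
    rw [LinearEquiv.apply_symm_apply]
    rfl
  one_right _ := rfl
  mul_right d c c' := by
    change LinearMap.mul' k k (TensorProduct.map ((toHDual k H).symm c) ((toHDual k H).symm c')
      (comul (R := k) d)) = _
    generalize comul (R := k) d = z
    induction z with
    | zero => simp
    | add s t hs ht => simp only [map_add, LinearMap.add_apply, hs, ht]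
    | tmul a b => simp [pairing]

lemma pairingOp_mul (ω θ : HDual k H) (c : Hᵐᵒᵖ) : pairingOp k H (ω * θ) c =
    tensorPairing (pairingOp k H) (pairingOp k H) (ω ⊗ₜ[k] θ) (comul (R := k) c) := by
  induction c using MulOpposite.rec' with | _ c => ?_
  have h : comul (R := k) (op c) = TensorProduct.map (opLinearEquiv k).toLinearMap
    (opLinearEquiv k).toLinearMap (comul (R := k) c) := rfl
  rw [pairingOp_op, (isDualPairing_pairing k H).mul_right, h]
  generalize comul (R := k) c = z
  induction z with
  | zero => simp
  | add s t hs ht => simp only [map_add, LinearMap.add_apply, hs, ht]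
  | tmul a b => simp

/-- The dual `Ĥᶜᵒ` of `H` with the opposite comultiplication. -/
def HDualCop : Type _ := HDual k H

instance : Ring (HDualCop k H) := inferInstanceAs (Ring (HDual k H))

instance : Algebra k (HDualCop k H) := inferInstanceAs (Algebra k (HDual k H))

instance : FiniteDimensional k (HDualCop k H) := inferInstanceAs (FiniteDimensional k (HDual k H))

instance : CoalgebraStruct k (HDualCop k H) where
  comul := (TensorProduct.comm k (HDual k H) (HDual k H)).toLinearMap ∘ₗ
    comul (R := k) (A := HDual k H)
  counit := counit (R := k) (A := HDual k H)

/-- The canonical pairing of `Ĥᶜᵒ` with `Hᵒᵖ`. -/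
def pairingCop : HDualCop k H →ₗ[k] Hᵐᵒᵖ →ₗ[k] k := pairingOp k H

/-- The reversed product of `Hᵒᵖ` is compensated by the flipped coproduct of `Ĥᶜᵒ`. The coproduct of
`Hᵒᵖ` is that of `H`, so the product of `Ĥ` is unchanged. -/
lemma isDualPairing_pairingCop : IsDualPairing (pairingCop k H) where
  isPerfPair := pairingOp_isPerfPair k H
  one_left _ := rfl
  mul_left d d' c := pairingOp_mul k H d d' c
  one_right _ := rfl
  mul_right d c c' := by
    induction c using MulOpposite.rec' with | _ c => ?_
    induction c' using MulOpposite.rec' with | _ c' => ?_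
    change pairing k H (c' * c) (show HDual k H from d) = _
    rw [(isDualPairing_pairing k H).mul_left]
    change _ = tensorPairing (pairingOp k H) (pairingOp k H)
      (TensorProduct.comm k (HDual k H) (HDual k H) (comul (R := k) (A := HDual k H) d))
      (op c ⊗ₜ[k] op c')
    generalize comul (R := k) (A := HDual k H) d = z
    induction z with
    | zero => simp
    | add s t hs ht => simp only [map_add, LinearMap.add_apply, hs, ht]
    | tmul a b => simp [mul_comm]

end FiniteDimensional

/-! ### The inverse of the antipode, and the canonical element -/

section FiniteDimensional

variable [FiniteDimensional k H]

lemma isUnit_antipode : IsUnit (antipode k : Module.End k H) :=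
  (Module.End.isUnit_iff _).2 (antipode_bijective k H)

variable {k H}

lemma antipode_antipodeInv (h : H) : antipode k (antipodeInv k H h) = h :=
  LinearMap.congr_fun (Ring.mul_inverse_cancel _ (isUnit_antipode k H)) h

variable (k H) in
lemma antipodeInv_one : antipodeInv k H 1 = 1 := by
  apply (antipode_bijective k H).injective
  rw [antipode_antipodeInv, antipode_one]

variable {R : Type*} [Ring R] [Algebra k R]

/-- The element `h ↦ j(hᵒᵖ)` of the convolution algebra. -/
def convOp (j : Hᵐᵒᵖ →ₐ[k] R) : WithConv (H →ₗ[k] R) :=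
  toConv (j.toLinearMap ∘ₗ (opLinearEquiv k).toLinearMap)

/-- The element `h ↦ j(S⁻¹(h)ᵒᵖ)` of the convolution algebra. -/
def convOpInv (j : Hᵐᵒᵖ →ₐ[k] R) : WithConv (H →ₗ[k] R) :=
  toConv (j.toLinearMap ∘ₗ (opLinearEquiv k).toLinearMap ∘ₗ antipodeInv k H)

/-- `S⁻¹(h₂) h₁ = ε(h)`. -/
lemma convOp_mul_convOpInv (j : Hᵐᵒᵖ →ₐ[k] R) : convOp j * convOpInv j = 1 := by
  apply ofConv_injective
  refine LinearMap.ext fun h => ?_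
  -- `S⁻¹` reverses products, so `S⁻¹(b) a = S⁻¹(S(a) b)`. The claim is therefore `S⁻¹` applied to
  -- the antipode law `S(h₁) h₂ = ε(h)`.
  have h1 (z : H ⊗[k] H) : LinearMap.mul' k R (TensorProduct.map (convOp j).ofConv
      (convOpInv j).ofConv z) = j (op (LinearEquiv.ofBijective _ (antipode_bijective k H) |>.symm
        (LinearMap.mul' k H ((antipode k).rTensor H z)))) := by
    induction z with
    | zero => simp
    | add s t hs ht => simp only [map_add, MulOpposite.op_add, hs, ht]
    | tmul a b =>
      have h2 : (LinearEquiv.ofBijective _ (antipode_bijective k H)).symm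
          (antipode k a * b) = antipodeInv k H b * a := by
        rw [LinearEquiv.symm_apply_eq]
        simp [antipode_mul_antidistrib, antipode_antipodeInv]
      simp only [TensorProduct.map_tmul, LinearMap.mul'_apply, LinearMap.rTensor_tmul, h2,
        MulOpposite.op_mul, map_mul]
      rfl
  refine (h1 _).trans ?_
  have h3 : (LinearEquiv.ofBijective _ (antipode_bijective k H)).symm (1 : H) = 1 := by
    rw [LinearEquiv.symm_apply_eq]
    simp
  rw [mul_antipode_rTensor_comul_apply, Algebra.algebraMap_eq_smul_one, map_smul, h3,
    MulOpposite.op_smul, map_smul, MulOpposite.op_one, map_one]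
  simp [Algebra.algebraMap_eq_smul_one]

/-- `h₂ S⁻¹(h₁) = ε(h)`. -/
lemma convOpInv_mul_convOp (j : Hᵐᵒᵖ →ₐ[k] R) : convOpInv j * convOp j = 1 := by
  apply ofConv_injective
  refine LinearMap.ext fun h => ?_
  have h1 (z : H ⊗[k] H) : LinearMap.mul' k R (TensorProduct.map (convOpInv j).ofConv
      (convOp j).ofConv z) = j (op (LinearEquiv.ofBijective _ (antipode_bijective k H) |>.symm
        (LinearMap.mul' k H ((antipode k).lTensor H z)))) := by
    induction z with
    | zero => simp
    | add s t hs ht => simp only [map_add, MulOpposite.op_add, hs, ht]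
    | tmul a b =>
      have h2 : (LinearEquiv.ofBijective _ (antipode_bijective k H)).symm
          (a * antipode k b) = b * antipodeInv k H a := by
        rw [LinearEquiv.symm_apply_eq]
        simp [antipode_mul_antidistrib, antipode_antipodeInv]
      simp only [TensorProduct.map_tmul, LinearMap.mul'_apply, LinearMap.lTensor_tmul, h2,
        MulOpposite.op_mul, map_mul]
      rfl
  refine (h1 _).trans ?_
  have h3 : (LinearEquiv.ofBijective _ (antipode_bijective k H)).symm (1 : H) = 1 := by
    rw [LinearEquiv.symm_apply_eq]
    simp
  rw [mul_antipode_lTensor_comul_apply, Algebra.algebraMap_eq_smul_one, map_smul, h3,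
    MulOpposite.op_smul, map_smul, MulOpposite.op_one, map_one]
  simp [Algebra.algebraMap_eq_smul_one]

variable (k H) in
/-- The slice map is an isomorphism of `X ⊗ Ĥ` with the convolution algebra `Hom(H, X)`. -/
def sliceEquiv (X : Type*) [Ring X] [Algebra k X] :
    X ⊗[k] HDual k H ≃+* WithConv (H →ₗ[k] X) where
  toEquiv := (Equiv.ofBijective _ (slice_bijective (X := X) (pairing k H))).trans
    (WithConv.equiv _).symm
  map_add' s t := congrArg toConv (map_add (slice (pairing k H)) s t)
  map_mul' s t := by
    apply ofConv_injective
    exact LinearMap.ext fun h => (isDualPairing_pairing k H).slice_mul s t h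

lemma sliceEquiv_apply {X : Type*} [Ring X] [Algebra k X] (t : X ⊗[k] HDual k H) :
    sliceEquiv k H X t = toConv (slice (pairing k H) t) := rfl

/-- Slicing `∑ hᵢ ⊗ hⁱ` at `h` is the expansion of `h` in the basis `(hᵢ)`. Computations with `°U`
thus become computations with `h ↦ hᵒᵖ` in the convolution algebra. -/
lemma sliceEquiv_canUop :
    sliceEquiv k H Hᵐᵒᵖ (canUop k H) = convOp (AlgHom.id k Hᵐᵒᵖ) := by
  apply ofConv_injective
  refine LinearMap.ext fun h => ?_
  change slice (pairing k H) (canUop k H) h = op h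
  rw [canUop, slice_rTensor, canU, coevaluation_apply_one]
  simp only [map_sum, LinearMap.lTensor_tmul, LinearMap.sum_apply, slice_tmul,
    LinearEquiv.coe_coe, pairing_toHDual]
  rw [← map_sum]
  exact congrArg op ((Module.Basis.ofVectorSpace k H).sum_repr h)

variable (k H) in
-- Bijectivity of the antipode enters here: the convolution inverse of `h ↦ hᵒᵖ` is `h ↦ S⁻¹(h)ᵒᵖ`.
lemma isUnit_canUop : IsUnit (canUop k H) := by
  rw [← MulEquiv.isUnit_map (sliceEquiv k H Hᵐᵒᵖ), sliceEquiv_canUop]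
  exact ⟨⟨_, _, convOp_mul_convOpInv _, convOpInv_mul_convOp _⟩, rfl⟩

lemma sliceEquiv_inverse_canUop :
    sliceEquiv k H Hᵐᵒᵖ (Ring.inverse (canUop k H)) = convOpInv (AlgHom.id k Hᵐᵒᵖ) := by
  refine left_inv_eq_right_inv ?_ (convOp_mul_convOpInv _)
  rw [← sliceEquiv_canUop, ← map_mul, Ring.inverse_mul_cancel _ (isUnit_canUop k H), map_one]

end FiniteDimensional

/-! ### Conjugation in the convolution algebra and the exchange map. -/

section Exchange

variable {k H} {R : Type*} [Ring R] [Algebra k R]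

/-- The exchange map is adjoint to the conjugation with `h ↦ j(hᵒᵖ)` in the convolution algebra. -/
lemma apply_conj_convOp {Z : Type*} [AddCommGroup Z] [Module k Z] (j : Hᵐᵒᵖ →ₐ[k] R)
    (q : HDual k H →ₗ[k] R →ₗ[k] Z)
    (hq : ∀ (θ : HDual k H) (a b : H) (r : R), q θ (j (op a) * r * j (op b)) =
      q (regularRight k H (regularLeft k H a θ) b) r)
    (f : H →ₗ[k] R) (a : H) (θ : HDual k H) :
    q θ ((convOp j * toConv f * convOpInv j).ofConv a) =
      TensorProduct.lift (q.compl₂ f) (exchange k H (a ⊗ₜ[k] θ)) := by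
  have h1 : (convOp j * toConv f * convOpInv j).ofConv =
      LinearMap.mul' k R ∘ₗ TensorProduct.map
        (LinearMap.mul' k R ∘ₗ TensorProduct.map (convOp j).ofConv f) (convOpInv j).ofConv ∘ₗ
          (comul (R := k) (A := H)).rTensor H ∘ₗ comul := by
    simp only [LinearMap.convMul_def, ofConv_toConv, LinearMap.rTensor, ← LinearMap.comp_assoc,
      ← TensorProduct.map_comp, LinearMap.comp_id]
  have h2 : exchange k H (a ⊗ₜ[k] θ) = (coadjointAux k H θ).rTensor H
      (TensorProduct.rightComm k H H H
        ((comul (R := k) (A := H)).rTensor H (comul (R := k) a))) := by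
    simp [exchange]
  rw [h1, h2]
  simp only [LinearMap.comp_apply]
  generalize (comul (R := k) (A := H)).rTensor H (comul (R := k) a) = y
  induction y with
  | zero => simp
  | add s t hs ht => simp only [map_add, hs, ht]
  | tmul z c =>
    induction z with
    | zero => simp
    | add s t hs ht => simp only [map_add, TensorProduct.add_tmul, hs, ht]
    | tmul a b =>
      -- Here `a`, `b`, `c` play the roles of `a₁`, `a₂`, `a₃`. The hypothesis `hq` carries the
      -- outer factors `j(a₁)` and `j(S⁻¹(a₃))` over to `a₁ ▶ θ ◀ S⁻¹(a₃)` and leaves `f(a₂)`.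
      have h3 := hq θ a (antipodeInv k H c) (f b)
      simpa [coadjointAux, convOp, convOpInv] using h3

end Exchange

/-! ### The pairing of the double with the codouble -/

section Twisted

variable {k} {A B A' B' : Type*} [Ring A] [Algebra k A] [Ring B] [Algebra k B]
  [Ring A'] [Algebra k A'] [Ring B'] [Algebra k B']

lemma twistedMul_tmul_tmul (T : B ⊗[k] A →ₗ[k] A ⊗[k] B) (a a' : A) (b b' : B) :
    twistedMul T ((a ⊗ₜ[k] b) ⊗ₜ[k] (a' ⊗ₜ[k] b')) =
      TensorProduct.map (LinearMap.mulLeft k a) (LinearMap.mulRight k b') (T (b ⊗ₜ[k] a')) := by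
  simp only [twistedMul, LinearMap.comp_apply, LinearEquiv.coe_coe,
    TensorProduct.tensorTensorTensorAssoc_tmul, LinearMap.rTensor_tmul, LinearMap.lTensor_tmul]
  generalize T (b ⊗ₜ[k] a') = w
  induction w with
  | zero => simp
  | add s t hs ht => simp only [map_add, TensorProduct.tmul_add, TensorProduct.add_tmul, hs, ht]
  | tmul a₁ b₁ => simp

/-- The map `(id ⊗ Σ T ⊗ id) (a₁ ⊗ a₂ ⊗ b₁ ⊗ b₂)` as a bilinear map. -/
def twistedTmul (T : A ⊗[k] B →ₗ[k] A ⊗[k] B) :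
    A ⊗[k] A →ₗ[k] B ⊗[k] B →ₗ[k] (A ⊗[k] B) ⊗[k] (A ⊗[k] B) :=
  TensorProduct.curry ((TensorProduct.tensorTensorTensorComm k A A B B).toLinearMap
    ∘ₗ (TensorProduct.tensorTensorTensorAssoc k A A B B).symm.toLinearMap
    ∘ₗ (T.lTensor A).rTensor B
    ∘ₗ (TensorProduct.tensorTensorTensorAssoc k A A B B).toLinearMap)

/-- `T` only sees the inner legs `a₂ ⊗ b₁`, so the outer legs split off as scalars. Because of the
flip, the `A`-leg of the output of `T` meets `x'` and its `B`-leg meets `y`. -/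
lemma tensorPairing_twistedTmul (p : A' →ₗ[k] A →ₗ[k] k) (q : B' →ₗ[k] B →ₗ[k] k)
    (T : A ⊗[k] B →ₗ[k] A ⊗[k] B) (x x' : A') (y y' : B') (a₁ a₂ : A) (b₁ b₂ : B) :
    tensorPairing (tensorPairing p q) (tensorPairing p q) ((x ⊗ₜ[k] y) ⊗ₜ[k] (x' ⊗ₜ[k] y'))
      (twistedTmul T (a₁ ⊗ₜ[k] a₂) (b₁ ⊗ₜ[k] b₂)) =
      p x a₁ * q y' b₂ * p x' (slice q (T (a₂ ⊗ₜ[k] b₁)) y) := by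
  simp only [twistedTmul, TensorProduct.curry_apply, LinearMap.comp_apply, LinearEquiv.coe_coe,
    TensorProduct.tensorTensorTensorAssoc_tmul, LinearMap.rTensor_tmul, LinearMap.lTensor_tmul]
  generalize T (a₂ ⊗ₜ[k] b₁) = w
  induction w with
  | zero => simp
  | add s t hs ht =>
    simp only [map_add, TensorProduct.tmul_add, TensorProduct.add_tmul, hs, ht,
      LinearMap.add_apply, mul_add]
  | tmul c d =>
    simp only [TensorProduct.tensorTensorTensorAssoc_symm_tmul,
      TensorProduct.tensorTensorTensorComm_tmul, tensorPairing_tmul, slice_tmul, map_smul,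
      smul_eq_mul]
    ring

end Twisted

section DoublePairing

variable [FiniteDimensional k H]

variable {k H} in
/-- The exchange map is adjoint to the conjugation with the canonical element. -/
lemma tensorPairing_exchange (a : H) (θ : HDual k H) (y : Hᵐᵒᵖ ⊗[k] HDual k H) :
    tensorPairing (pairingOp k H) (pairing k H) (exchange k H (a ⊗ₜ[k] θ)) y =
      pairingOp k H θ (slice (pairing k H) (Ad (k := k) (canUop k H) y) a) := by
  -- The ring isomorphism `sliceEquiv` turns `Ad(°U)` into conjugation by `h ↦ hᵒᵖ`.
  have h1 : toConv (slice (pairing k H) (Ad (k := k) (canUop k H) y)) =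
      convOp (AlgHom.id k Hᵐᵒᵖ) * toConv (slice (pairing k H) y) *
        convOpInv (AlgHom.id k Hᵐᵒᵖ) := by
    rw [← sliceEquiv_canUop, ← sliceEquiv_inverse_canUop, ← sliceEquiv_apply, ← sliceEquiv_apply,
      ← map_mul, ← map_mul, mul_assoc]
    rfl
  have h2 := apply_conj_convOp (AlgHom.id k Hᵐᵒᵖ) (pairingOp k H) (fun θ a b r => by
    induction r using MulOpposite.rec' with | _ r => ?_
    simp [← MulOpposite.op_mul, pairing_regular, mul_assoc])
    (slice (pairing k H) y) a θ
  rw [← h1] at h2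
  refine Eq.trans ?_ h2.symm
  clear h1 h2
  generalize exchange k H (a ⊗ₜ[k] θ) = w
  induction w with
  | zero => simp
  | add s t hs ht => simp only [map_add, LinearMap.add_apply, hs, ht]
  | tmul ω b =>
    induction y with
    | zero => simp
    | add s t hs ht =>
      simp only [LinearMap.compl₂_apply, TensorProduct.lift.tmul] at *
      rw [map_add, map_add, LinearMap.add_apply, map_add, hs, ht]
    | tmul c η => simp [mul_comm]

variable {k H} in
-- The outer multiplications move across the pairing as slices of coproducts: `c` becomes `ω(c₁)
-- c₂`, and `η` becomes `η₁ η₂(b)`.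
lemma tensorPairing_map_mulLeft_mulRight (ω : HDual k H) (b : H) (w : HDual k H ⊗[k] H) (c : Hᵐᵒᵖ)
    (η : HDual k H) :
    tensorPairing (pairingOp k H) (pairing k H)
      (TensorProduct.map (LinearMap.mulLeft k ω) (LinearMap.mulRight k b) w) (c ⊗ₜ[k] η) =
      tensorPairing (pairingOp k H) (pairing k H) w
        (slice (pairingOp k H) (TensorProduct.comm k _ _ (comul (R := k) c)) ω ⊗ₜ[k]
          slice (pairing k H) (comul (R := k) η) b) := by
  induction w with
  | zero => simp
  | add s t hs ht => simp only [map_add, LinearMap.add_apply, hs, ht]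
  | tmul ω' a' =>
    simp only [TensorProduct.map_tmul, tensorPairing_tmul, LinearMap.mulLeft_apply,
      LinearMap.mulRight_apply]
    rw [pairingOp_mul, (isDualPairing_pairing k H).mul_left]
    congr 1
    · generalize comul (R := k) c = z
      induction z with
      | zero => simp
      | add s t hs ht => simp only [map_add, LinearMap.add_apply, hs, ht]
      | tmul c c' => simp
    · generalize comul (R := k) η = z
      induction z with
      | zero => simp
      | add s t hs ht => simp only [map_add, LinearMap.add_apply, hs, ht]
      | tmul c c' => simp [mul_comm]

/-- The product of the double is dual to the twisted coproduct of the codouble. On elementary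
tensors both sides carry the scalar `ω(c₁) η₂(b)`; what remains is the adjointness
`tensorPairing_exchange` for `c₂ ⊗ η₁`. -/
lemma tensorPairing_twistedMul (d d' : HDual k H ⊗[k] H) (y : Hᵐᵒᵖ ⊗[k] HDual k H) :
    tensorPairing (pairingOp k H) (pairing k H) (twistedMul (exchange k H) (d ⊗ₜ[k] d')) y =
      tensorPairing (tensorPairing (pairingOp k H) (pairing k H))
        (tensorPairing (pairingOp k H) (pairing k H)) (d ⊗ₜ[k] d')
        (twistedComul (canUop k H) y) := by
  induction y with
  | zero => simp
  | add s t hs ht => simp only [map_add, hs, ht]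
  | tmul c η =>
  induction d with
  | zero => simp
  | add s t hs ht => simp only [map_add, LinearMap.add_apply, TensorProduct.add_tmul, hs, ht]
  | tmul ω a =>
  induction d' with
  | zero => simp
  | add s t hs ht => simp only [map_add, LinearMap.add_apply, TensorProduct.tmul_add, hs, ht]
  | tmul θ b =>
  rw [twistedMul_tmul_tmul, tensorPairing_map_mulLeft_mulRight]
  change _ = tensorPairing _ _ _ (twistedTmul (Ad (canUop k H)) (comul (R := k) c)
    (comul (R := k) η))
  generalize comul (R := k) c = z
  generalize comul (R := k) η = w
  induction z with
  | zero => simp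
  | add s t hs ht => simp only [map_add, LinearMap.add_apply, TensorProduct.add_tmul, hs, ht]
  | tmul c₁ c₂ =>
  induction w with
  | zero => simp
  | add s t hs ht => simp only [map_add, LinearMap.add_apply, TensorProduct.tmul_add, hs, ht]
  | tmul η₁ η₂ =>
  rw [tensorPairing_twistedTmul, TensorProduct.comm_tmul, slice_tmul, slice_tmul,
    TensorProduct.smul_tmul_smul, map_smul, tensorPairing_exchange, smul_eq_mul]

/-- The canonical pairing of the Drinfeld double with the Drinfeld codouble. -/
lemma isDualPairing_pairingDouble : IsDualPairing (pairingDouble k H) where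
  isPerfPair := inferInstance
  one_left c := by
    change tensorPairing (pairingOp k H) (pairing k H) (1 ⊗ₜ[k] 1) c =
      tensorCounit Hᵐᵒᵖ (HDual k H) c
    refine LinearMap.congr_fun (TensorProduct.ext' fun c η => ?_) c
    rw [tensorPairing_tmul]
    rfl
  mul_left d d' c := tensorPairing_twistedMul k H d d' c
  one_right d := by
    change tensorPairing (pairingOp k H) (pairing k H) d (1 ⊗ₜ[k] 1) =
      tensorCounit (HDual k H) H d
    generalize (show HDual k H ⊗[k] H from d) = d
    induction d with
    | zero => simp
    | add s t hs ht => simp only [map_add, LinearMap.add_apply, hs, ht]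
    | tmul ω h =>
      rw [tensorPairing_tmul]
      rfl
  mul_right d c c' := by
    have key (d : HDual k H ⊗[k] H) (c c' : Hᵐᵒᵖ ⊗[k] HDual k H) :
        tensorPairing (pairingOp k H) (pairing k H) d (c * c') =
        tensorPairing (tensorPairing (pairingOp k H) (pairing k H))
          (tensorPairing (pairingOp k H) (pairing k H)) (coTensorComul (HDual k H) H d)
          (c ⊗ₜ[k] c') := by
      induction c with
      | zero => simp
      | add s t hs ht => simp only [map_add, add_mul, TensorProduct.add_tmul, hs, ht]
      | tmul c η =>
      induction c' with
      | zero => simp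
      | add s t hs ht => simp only [map_add, mul_add, TensorProduct.tmul_add, hs, ht]
      | tmul c' η' =>
      induction d with
      | zero => simp
      | add s t hs ht => simp only [map_add, LinearMap.add_apply, hs, ht]
      | tmul ω h =>
      have h1 : pairingOp k H ω (c * c') = tensorPairing (pairingOp k H) (pairingOp k H)
        (TensorProduct.comm k _ _ (comul (R := k) ω)) (c ⊗ₜ[k] c') :=
        (isDualPairing_pairingCop k H).mul_right ω c c'
      rw [Algebra.TensorProduct.tmul_mul_tmul, tensorPairing_tmul, h1,
        (isDualPairing_pairing k H).mul_right]
      simp only [coTensorComul, LinearMap.comp_apply, TensorProduct.map_tmul, LinearEquiv.coe_coe]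
      generalize comul (R := k) ω = z
      generalize comul (R := k) h = w
      induction z with
      | zero => simp
      | add s t hs ht =>
        simp only [map_add, LinearMap.add_apply, TensorProduct.add_tmul, add_mul, hs, ht]
      | tmul ω₁ ω₂ =>
      induction w with
      | zero => simp
      | add s t hs ht =>
        simp only [map_add, LinearMap.add_apply, TensorProduct.tmul_add, mul_add, hs, ht]
      | tmul a b => simp; ring
    exact key d c c'

end DoublePairing

end DualPairings

section Compatibility

open HopfAlgebra WithConv MulOpposite

variable {k : Type u} {H : Type v} [Field k] [Ring H] [HopfAlgebra k H]
  {X : Type w} [Ring X] [Algebra k X]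

/-! ### The Yetter-Drinfeld compatibility condition -/

/-- The map `h ↦ (h ▷ x₀) ⊗ x₁`. -/
def actCoact (act : H →ₗ[k] X →ₗ[k] X) (δ : X →ₐ[k] X ⊗[k] Hᵐᵒᵖ) (x : X) :
    H →ₗ[k] X ⊗[k] Hᵐᵒᵖ :=
  (LinearMap.rTensorHom Hᵐᵒᵖ ∘ₗ act).flip (δ x)

lemma actCoact_apply (act : H →ₗ[k] X →ₗ[k] X) (δ : X →ₐ[k] X ⊗[k] Hᵐᵒᵖ) (x : X) (h : H) :
    actCoact act δ x h = (act h).rTensor Hᵐᵒᵖ (δ x) := rfl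

/-- The map `h ↦ (h ▷ x)₀ ⊗ (h ▷ x)₁`. -/
def coactAct (act : H →ₗ[k] X →ₗ[k] X) (δ : X →ₐ[k] X ⊗[k] Hᵐᵒᵖ) (x : X) :
    H →ₗ[k] X ⊗[k] Hᵐᵒᵖ :=
  δ.toLinearMap ∘ₗ act.flip x

variable (k H X) in
/-- The inclusion `cᵒᵖ ↦ 1 ⊗ cᵒᵖ`. -/
abbrev inclOp : Hᵐᵒᵖ →ₐ[k] X ⊗[k] Hᵐᵒᵖ := Algebra.TensorProduct.includeRight

/-- The product `h₂ x₁` in `H` is `x₁ᵒᵖ h₂ᵒᵖ` in `Hᵒᵖ`. This side of the compatibility condition is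
thus a convolution product with `h ↦ 1 ⊗ hᵒᵖ` on the right; in the lemma that follows the factor
stands on the left. -/
lemma op_actCoact_side (act : H →ₗ[k] X →ₗ[k] X) (t : X ⊗[k] Hᵐᵒᵖ) (z : H ⊗[k] H) :
    (opLinearEquiv k (M := H)).toLinearMap.lTensor X (TensorProduct.map (TensorProduct.lift act)
        (LinearMap.mul' k H ∘ₗ (MulOpposite.opLinearEquiv k).symm.toLinearMap.lTensor H)
        (TensorProduct.tensorTensorTensorComm k H H X Hᵐᵒᵖ (z ⊗ₜ[k] t))) =
      LinearMap.mul' k _ (TensorProduct.map ((LinearMap.rTensorHom Hᵐᵒᵖ ∘ₗ act).flip t)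
        (convOp (inclOp k H X)).ofConv z) := by
  induction z with
  | zero => simp
  | add s t hs ht => simp only [map_add, TensorProduct.add_tmul, hs, ht]
  | tmul a b =>
    induction t with
    | zero => simp
    | add s t hs ht =>
      simp only [map_add, TensorProduct.tmul_add, hs, ht, LinearMap.add_apply,
        TensorProduct.map_tmul, LinearMap.mul'_apply, add_mul]
    | tmul x c => simp [convOp]

lemma op_coactAct_side (f : H →ₗ[k] X ⊗[k] Hᵐᵒᵖ) (z : H ⊗[k] H) :
    (opLinearEquiv k (M := H)).toLinearMap.lTensor X
      ((LinearMap.mul' k H ∘ₗ (TensorProduct.comm k H H).toLinearMap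
          ∘ₗ (MulOpposite.opLinearEquiv k).symm.toLinearMap.lTensor H).lTensor X
        (TensorProduct.leftComm k H X Hᵐᵒᵖ (f.lTensor H z))) =
      LinearMap.mul' k _ (TensorProduct.map (convOp (inclOp k H X)).ofConv f z) := by
  induction z with
  | zero => simp
  | add s t hs ht => simp only [map_add, hs, ht]
  | tmul a b =>
    simp only [LinearMap.lTensor_tmul, TensorProduct.map_tmul, LinearMap.mul'_apply]
    generalize f b = t
    induction t with
    | zero => simp
    | add s t hs ht => simp only [map_add, TensorProduct.tmul_add, hs, ht, mul_add]
    | tmul x c => simp [convOp]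

/-- The common normal form of the compatibility conditions: an intertwining relation for the element
`h ↦ 1 ⊗ hᵒᵖ` of `Hom(H, X ⊗ Hᵒᵖ)`. -/
lemma leftRight_compat_iff (act : H →ₗ[k] X →ₗ[k] X) (δ : X →ₐ[k] X ⊗[k] Hᵐᵒᵖ) (x : X) :
    (∀ h : H, TensorProduct.map (TensorProduct.lift act)
        (LinearMap.mul' k H ∘ₗ (MulOpposite.opLinearEquiv k).symm.toLinearMap.lTensor H)
        (TensorProduct.tensorTensorTensorComm k H H X Hᵐᵒᵖ (comul (R := k) h ⊗ₜ[k] δ x)) =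
      (LinearMap.mul' k H ∘ₗ (TensorProduct.comm k H H).toLinearMap
          ∘ₗ (MulOpposite.opLinearEquiv k).symm.toLinearMap.lTensor H).lTensor X
        (TensorProduct.leftComm k H X Hᵐᵒᵖ
          ((δ.toLinearMap ∘ₗ act.flip x).lTensor H (comul (R := k) h)))) ↔
    toConv (actCoact act δ x) * convOp (inclOp k H X) =
      convOp (inclOp k H X) * toConv (coactAct act δ x) := by
  have hinj : Function.Injective ((opLinearEquiv k (M := H)).toLinearMap.lTensor X) :=
    (LinearEquiv.lTensor X (opLinearEquiv k (M := H))).injective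
  rw [← ofConv_injective.eq_iff, LinearMap.ext_iff]
  refine forall_congr' fun h => ?_
  rw [← hinj.eq_iff, op_actCoact_side, op_coactAct_side]
  rfl

lemma slice_assoc_symm_tmul (x : X) (y : Hᵐᵒᵖ ⊗[k] HDual k H) (h : H) :
    slice (pairing k H) ((TensorProduct.assoc k X Hᵐᵒᵖ (HDual k H)).symm (x ⊗ₜ[k] y)) h =
      x ⊗ₜ[k] slice (pairing k H) y h := by
  induction y with
  | zero => simp
  | add s t hs ht => simp only [map_add, TensorProduct.tmul_add, LinearMap.add_apply, hs, ht]
  | tmul c η => simp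

lemma radfordAction_tmul (act : H →ₗ[k] X →ₗ[k] X) (δ : X →ₐ[k] X ⊗[k] Hᵐᵒᵖ) (ω : HDual k H)
    (h : H) (x : X) :
    radfordAction k H act δ (ω ⊗ₜ[k] h : HDual k H ⊗[k] H) x =
      inducedAction (pairingOp k H) δ.toLinearMap ω (act h x) := by
  rfl

lemma lTensor_Ad {B : Type*} [Ring B] [Algebra k B] (V : B) (t : X ⊗[k] B) :
    (Ad (k := k) V).lTensor X t = (1 ⊗ₜ[k] V) * t * (1 ⊗ₜ[k] Ring.inverse V) := by
  induction t with
  | zero => simp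
  | add s t hs ht => simp only [map_add, hs, ht, mul_add, add_mul]
  | tmul x y => simp [Ad, mul_assoc]

variable [FiniteDimensional k H]

/-- Since `convOp j` is invertible, the relation can be solved for `g`, which gives the exchange
rule. In the next lemma it is solved for `f`, which gives the form with `Ad(°U)⁻¹`. -/
lemma mul_convOp_eq_convOp_mul_iff {R : Type*} [Ring R] [Algebra k R] (j : Hᵐᵒᵖ →ₐ[k] R)
    (f g : WithConv (H →ₗ[k] R)) :
    g * convOp j = convOp j * f ↔ g = convOp j * f * convOpInv j := by
  constructor
  · intro h
    rw [← h, mul_assoc, convOp_mul_convOpInv, mul_one]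
  · intro h
    rw [h, mul_assoc, convOpInv_mul_convOp, mul_one]

lemma convOp_mul_eq_iff {R : Type*} [Ring R] [Algebra k R] (j : Hᵐᵒᵖ →ₐ[k] R)
    (f g : WithConv (H →ₗ[k] R)) :
    g * convOp j = convOp j * f ↔ f = convOpInv j * g * convOp j := by
  constructor
  · intro h
    rw [mul_assoc, h, ← mul_assoc, convOpInv_mul_convOp, one_mul]
  · intro h
    rw [h, mul_assoc, ← mul_assoc, convOp_mul_convOpInv, one_mul]

variable (k H X) in
/-- The isomorphism of `X ⊗ (Hᵒᵖ ⊗ Ĥ)` with the convolution algebra `Hom(H, X ⊗ Hᵒᵖ)`. -/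
def sliceAssocEquiv : X ⊗[k] (Hᵐᵒᵖ ⊗[k] HDual k H) ≃+* WithConv (H →ₗ[k] X ⊗[k] Hᵐᵒᵖ) :=
  (Algebra.TensorProduct.assoc k k k X Hᵐᵒᵖ (HDual k H)).symm.toRingEquiv.trans
    (sliceEquiv k H (X ⊗[k] Hᵐᵒᵖ))

lemma sliceAssocEquiv_apply (t : X ⊗[k] (Hᵐᵒᵖ ⊗[k] HDual k H)) :
    sliceAssocEquiv k H X t =
      toConv (slice (pairing k H) ((TensorProduct.assoc k X Hᵐᵒᵖ (HDual k H)).symm t)) := rfl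

lemma sliceAssocEquiv_canUop :
    sliceAssocEquiv k H X (1 ⊗ₜ[k] canUop k H) = convOp (inclOp k H X) := by
  apply ofConv_injective
  refine LinearMap.ext fun h => ?_
  refine (slice_assoc_symm_tmul 1 (canUop k H) h).trans ?_
  rw [show slice (pairing k H) (canUop k H) h = _ from
    congr(($sliceEquiv_canUop).ofConv h)]
  rfl

lemma sliceAssocEquiv_inverse_canUop :
    sliceAssocEquiv k H X (1 ⊗ₜ[k] Ring.inverse (canUop k H)) = convOpInv (inclOp k H X) := by
  apply ofConv_injective
  refine LinearMap.ext fun h => ?_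
  refine (slice_assoc_symm_tmul 1 (Ring.inverse (canUop k H)) h).trans ?_
  rw [show slice (pairing k H) (Ring.inverse (canUop k H)) h = _ from
    congr(($sliceEquiv_inverse_canUop).ofConv h)]
  rfl

variable (k H) in
-- `Ad` of the inverse of `°U` multiplies on the right by the inverse of that inverse. As
-- `Ring.inverse` is zero off the units, invertibility of `°U` is essential.
lemma inverse_inverse_canUop : Ring.inverse (Ring.inverse (canUop k H)) = canUop k H := by
  obtain ⟨u, hu⟩ := isUnit_canUop k H
  rw [← hu, Ring.inverse_unit, Ring.inverse_unit, inv_inv]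

lemma slice_assoc_coact (δ : X →ₐ[k] X ⊗[k] Hᵐᵒᵖ) (β : X →ₐ[k] X ⊗[k] HDual k H) (x : X) :
    sliceAssocEquiv k H X (TensorProduct.assoc k X Hᵐᵒᵖ (HDual k H)
      (δ.toLinearMap.rTensor (HDual k H) (β x))) = toConv (coactAct (actionOfBeta k H β) δ x) := by
  rw [sliceAssocEquiv_apply, LinearEquiv.symm_apply_apply]
  congr 1
  refine LinearMap.ext fun h => ?_
  rw [slice_rTensor]
  rfl

lemma slice_comm_coact (δ : X →ₐ[k] X ⊗[k] Hᵐᵒᵖ) (β : X →ₐ[k] X ⊗[k] HDual k H) (x : X) :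
    sliceAssocEquiv k H X ((TensorProduct.comm k (HDual k H) Hᵐᵒᵖ).toLinearMap.lTensor X
      (TensorProduct.assoc k X (HDual k H) Hᵐᵒᵖ (β.toLinearMap.rTensor Hᵐᵒᵖ (δ x)))) =
      toConv (actCoact (actionOfBeta k H β) δ x) := by
  rw [sliceAssocEquiv_apply]
  congr 1
  refine LinearMap.ext fun h => ?_
  rw [actCoact_apply]
  generalize δ x = t
  induction t with
  | zero => simp
  | add s t hs ht => simp only [map_add, LinearMap.add_apply, hs, ht]
  | tmul y c =>
    have h1 : actionOfBeta k H β h y = slice (pairing k H) (β y) h := rfl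
    rw [LinearMap.rTensor_tmul, LinearMap.rTensor_tmul, h1, AlgHom.toLinearMap_apply]
    generalize β y = w
    induction w with
    | zero => simp
    | add s t hs ht =>
      simp only [map_add, TensorProduct.add_tmul, LinearMap.add_apply, hs, ht]
    | tmul z η => simp [TensorProduct.smul_tmul']

/-- Slicing the leg in `Ĥ` turns `(α ⊗ id) β` into `coactAct`, `(β ⊗ id) α` into `actCoact`, and
`Ad(°U)⁻¹` into conjugation. The equation becomes the intertwining relation solved for `coactAct`.
-/
lemma rightRight_compat_iff (α : X →ₐ[k] X ⊗[k] Hᵐᵒᵖ) (β : X →ₐ[k] X ⊗[k] HDual k H) :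
    (TensorProduct.assoc k X Hᵐᵒᵖ (HDual k H)).toLinearMap
      ∘ₗ α.toLinearMap.rTensor (HDual k H) ∘ₗ β.toLinearMap =
    (Ad (k := k) (Ring.inverse (canUop k H))).lTensor X
      ∘ₗ (TensorProduct.comm k (HDual k H) Hᵐᵒᵖ).toLinearMap.lTensor X
      ∘ₗ (TensorProduct.assoc k X (HDual k H) Hᵐᵒᵖ).toLinearMap
      ∘ₗ β.toLinearMap.rTensor Hᵐᵒᵖ ∘ₗ α.toLinearMap ↔
    ∀ x, toConv (actCoact (actionOfBeta k H β) α x) * convOp (inclOp k H X) =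
      convOp (inclOp k H X) * toConv (coactAct (actionOfBeta k H β) α x) := by
  rw [LinearMap.ext_iff]
  refine forall_congr' fun x => ?_
  rw [convOp_mul_eq_iff, ← (sliceAssocEquiv k H X).injective.eq_iff]
  simp only [LinearMap.comp_apply, LinearEquiv.coe_coe, AlgHom.toLinearMap_apply]
  rw [slice_assoc_coact, lTensor_Ad, inverse_inverse_canUop, map_mul, map_mul, slice_comm_coact,
    sliceAssocEquiv_canUop, sliceAssocEquiv_inverse_canUop]

/-- The compatibility condition of left-right Yetter-Drinfeld algebras expressed as a commutation
relation between the actions of `H` and `Ĥ`. -/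
lemma leftRight_compat_iff_exchange (act : H →ₗ[k] X →ₗ[k] X) (δ : X →ₐ[k] X ⊗[k] Hᵐᵒᵖ) (x : X) :
    toConv (actCoact act δ x) * convOp (inclOp k H X) =
      convOp (inclOp k H X) * toConv (coactAct act δ x) ↔
    ∀ (a : H) (θ : HDual k H), act a (inducedAction (pairingOp k H) δ.toLinearMap θ x) =
      radfordAction k H act δ (exchange k H (a ⊗ₜ[k] θ)) x := by
  rw [mul_convOp_eq_convOp_mul_iff, ← ofConv_injective.eq_iff, LinearMap.ext_iff]
  refine forall_congr' fun a => ?_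
  rw [← (slice_bijective (X := X) (pairingOp k H)).injective.eq_iff, LinearMap.ext_iff]
  refine forall_congr' fun θ => ?_
  have h1 := apply_conj_convOp (inclOp k H X) (slice (X := X) (pairingOp k H)).flip
    (fun θ a b r => by
      induction r with
      | zero => simp
      | add s t hs ht => simp only [mul_add, add_mul, map_add, hs, ht]
      | tmul x c =>
        induction c using MulOpposite.rec' with | _ c => ?_
        simp [← MulOpposite.op_mul, pairing_regular, mul_assoc])
    (coactAct act δ x) a θ
  have h2 (w : HDual k H ⊗[k] H) : TensorProduct.lift
      ((slice (X := X) (pairingOp k H)).flip.compl₂ (coactAct act δ x)) w =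
      radfordAction k H act δ w x := by
    induction w with
    | zero =>
      rw [map_zero]
      exact (LinearMap.congr_fun (map_zero (radfordAction k H act δ)) x).symm
    | add s t hs ht =>
      rw [map_add, hs, ht]
      exact (LinearMap.congr_fun (map_add (radfordAction k H act δ) s t) x).symm
    | tmul ω h =>
      rw [radfordAction_tmul]
      rfl
  rw [h2] at h1
  rw [← h1]
  change _ ↔ _ = slice (pairingOp k H) ((convOp (inclOp k H X) * toConv (coactAct act δ x) *
    convOpInv (inclOp k H X)).ofConv a) θ
  rw [ofConv_toConv, actCoact_apply, slice_rTensor]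
  rfl

end Compatibility

section DoubleActions

open HopfAlgebra WithConv MulOpposite

variable {k : Type u} {H : Type v} [Field k] [Ring H] [HopfAlgebra k H]
  {X : Type w} [Ring X] [Algebra k X]

/-! ### Module algebras over the Drinfeld double -/

variable (k H) in
/-- The element `ω ⋈ h` of the Drinfeld double. -/
def bowtie : HDual k H →ₗ[k] H →ₗ[k] Double k H := TensorProduct.mk k (HDual k H) H

lemma double_induction {motive : Double k H → Prop} (d : Double k H) (zero : motive 0)
    (add : ∀ d d', motive d → motive d' → motive (d + d'))
    (bowtie : ∀ ω h, motive (bowtie k H ω h)) : motive d :=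
  TensorProduct.induction_on (motive := motive) d zero bowtie add

lemma bowtie_mul_bowtie (ω θ : HDual k H) (a b : H) :
    bowtie k H ω a * bowtie k H θ b = (TensorProduct.map (LinearMap.mulLeft k ω)
      (LinearMap.mulRight k b) (exchange k H (a ⊗ₜ[k] θ)) : HDual k H ⊗[k] H) :=
  twistedMul_tmul_tmul (exchange k H) ω θ a b

lemma exchange_tmul (a : H) (θ : HDual k H) :
    exchange k H (a ⊗ₜ[k] θ) = (coadjointAux k H θ).rTensor H
      (TensorProduct.rightComm k H H H
        ((comul (R := k) (A := H)).rTensor H (comul (R := k) a))) := by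
  simp [exchange]

lemma radfordAction_bowtie (act : H →ₗ[k] X →ₗ[k] X) (δ : X →ₐ[k] X ⊗[k] Hᵐᵒᵖ) (ω : HDual k H)
    (h : H) (x : X) : radfordAction k H act δ (bowtie k H ω h) x =
      inducedAction (pairingOp k H) δ.toLinearMap ω (act h x) :=
  radfordAction_tmul act δ ω h x

/-- The exchange map is the commutation rule between the two factors of the double. Through it the
compatibility condition becomes multiplicativity of an action. -/
lemma one_bowtie_mul_bowtie_one (a : H) (θ : HDual k H) :
    bowtie k H 1 a * bowtie k H θ 1 = exchange k H (a ⊗ₜ[k] θ) := by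
  rw [bowtie_mul_bowtie, LinearMap.mulLeft_one, LinearMap.mulRight_one, TensorProduct.map_id]
  rfl

/-- The coaction `γ` of the codouble induces the action of the double built from `▷_β` and `α`. -/
lemma actionOfGamma_gamma (α : X →ₐ[k] X ⊗[k] Hᵐᵒᵖ) (β : X →ₐ[k] X ⊗[k] HDual k H) :
    actionOfGamma k H (gamma k H α β) = radfordAction k H (actionOfBeta k H β) α := by
  refine LinearMap.ext fun d => LinearMap.ext fun x => ?_
  induction d using double_induction with
  | zero => simp
  | add d d' hd hd' => simp only [map_add, LinearMap.add_apply, hd, hd']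
  | bowtie ω h =>
    rw [radfordAction_bowtie]
    have key (t : X ⊗[k] HDual k H) :
        slice (tensorPairing (pairingOp k H) (pairing k H))
          (TensorProduct.assoc k X Hᵐᵒᵖ (HDual k H) (α.toLinearMap.rTensor _ t)) (ω ⊗ₜ[k] h) =
        inducedAction (pairingOp k H) α.toLinearMap ω (slice (pairing k H) t h) := by
      induction t with
      | zero => simp
      | add s t hs ht => simp only [map_add, LinearMap.add_apply, hs, ht]
      | tmul y η =>
        rw [slice_tmul, map_smul, LinearMap.rTensor_tmul]
        change _ = pairing k H h η • slice (pairingOp k H) (α y) ω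
        rw [AlgHom.toLinearMap_apply]
        generalize α y = w
        induction w with
        | zero => simp
        | add s t hs ht =>
          simp only [map_add, TensorProduct.add_tmul, LinearMap.add_apply, hs, ht, smul_add]
        | tmul z c => simp [smul_smul, mul_comm]
    exact key (β x)

variable [FiniteDimensional k H]

lemma exchange_one_tmul (θ : HDual k H) : exchange k H (1 ⊗ₜ[k] θ) = θ ⊗ₜ[k] 1 := by
  have h : regularRight k H (regularLeft k H 1 θ) 1 = θ := by
    apply (toHDual k H).symm.injective
    refine LinearMap.ext fun x => ?_
    change pairing k H (1 * x * 1) θ = pairing k H x θ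
    rw [one_mul, mul_one]
  rw [exchange_tmul, Bialgebra.comul_one, Algebra.TensorProduct.one_def, LinearMap.rTensor_tmul,
    Bialgebra.comul_one, Algebra.TensorProduct.one_def]
  simp [coadjointAux, antipodeInv_one, h]

lemma counit_antipodeInv (h : H) : counit (R := k) (antipodeInv k H h) = counit (R := k) h := by
  conv_rhs => rw [← antipode_antipodeInv (k := k) h, counit_antipode]

/-- The unit of `Ĥ` is the character `ε`, which both regular actions merely scale by `ε`. As `ε ∘
S⁻¹ = ε`, the outer legs of `a₁ ⊗ a₂ ⊗ a₃` collapse. -/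
lemma exchange_tmul_one (a : H) : exchange k H (a ⊗ₜ[k] 1) = 1 ⊗ₜ[k] a := by
  have h (y : H ⊗[k] H ⊗[k] H) : (coadjointAux k H 1).rTensor H
      (TensorProduct.rightComm k H H H y) = 1 ⊗ₜ[k] (TensorProduct.lid k H
        ((counit (R := k) (A := H)).rTensor H
          (TensorProduct.rid k (H ⊗[k] H) ((counit (R := k) (A := H)).lTensor _ y)))) := by
    induction y with
    | zero => simp
    | add s t hs ht => simp only [map_add, TensorProduct.tmul_add, hs, ht]
    | tmul z c =>
      induction z with
      | zero => simp
      | add s t hs ht => simp only [map_add, TensorProduct.add_tmul, TensorProduct.tmul_add, hs, ht]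
      | tmul a b =>
        have h1 : regularRight k H (regularLeft k H a 1) (antipodeInv k H c) =
            (counit (R := k) c * counit (R := k) a) • (1 : HDual k H) := by
          apply (toHDual k H).symm.injective
          refine LinearMap.ext fun x => ?_
          change counit (R := k) (antipodeInv k H c * x * a) =
            (counit (R := k) c * counit (R := k) a) * counit (R := k) x
          rw [Bialgebra.counit_mul, Bialgebra.counit_mul, counit_antipodeInv]
          ring
        simp [coadjointAux, h1, TensorProduct.smul_tmul, smul_smul]
  rw [exchange_tmul, h]
  have h2 (z : H ⊗[k] H) : TensorProduct.rid k (H ⊗[k] H) ((counit (R := k) (A := H)).lTensor _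
      ((comul (R := k) (A := H)).rTensor H z)) =
      comul (R := k) (TensorProduct.rid k H ((counit (R := k) (A := H)).lTensor _ z)) := by
    induction z with
    | zero => simp
    | add s t hs ht => simp only [map_add, hs, ht]
    | tmul a b => simp
  rw [h2, lTensor_counit_comul, TensorProduct.rid_tmul, one_smul, rTensor_counit_comul,
    TensorProduct.lid_tmul, one_smul]

lemma bowtie_mul_one_bowtie (ω : HDual k H) (h : H) :
    bowtie k H ω 1 * bowtie k H 1 h = bowtie k H ω h := by
  rw [bowtie_mul_bowtie, exchange_one_tmul, TensorProduct.map_tmul]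
  simp only [LinearMap.mulLeft_apply, LinearMap.mulRight_apply, one_mul, mul_one]
  rfl

lemma bowtie_one_mul_bowtie_one (ω θ : HDual k H) :
    bowtie k H ω 1 * bowtie k H θ 1 = bowtie k H (ω * θ) 1 := by
  rw [bowtie_mul_bowtie, exchange_one_tmul, TensorProduct.map_tmul]
  simp only [LinearMap.mulLeft_apply, LinearMap.mulRight_apply, mul_one]
  rfl

lemma one_bowtie_mul_one_bowtie (a b : H) :
    bowtie k H 1 a * bowtie k H 1 b = bowtie k H 1 (a * b) := by
  rw [bowtie_mul_bowtie, exchange_tmul_one, TensorProduct.map_tmul]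
  simp only [LinearMap.mulLeft_apply, LinearMap.mulRight_apply, mul_one]
  rfl

variable (k H) in
-- Dual to the multiplicativity of `ε`.
lemma comul_one_HDual : comul (R := k) (1 : HDual k H) = 1 ⊗ₜ[k] 1 := by
  apply (LinearMap.IsPerfPair.bijective_right
    (tensorPairing (pairing k H) (pairing k H))).injective
  refine TensorProduct.ext' fun a b => ?_
  rw [LinearMap.flip_apply, ← (isDualPairing_pairing k H).mul_left, LinearMap.flip_apply,
    tensorPairing_tmul]
  exact Bialgebra.counit_mul a b

variable (k H) in
/-- The map `(ω ⊗ θ, a ⊗ b) ↦ (ω ⋈ a) ⊗ (θ ⋈ b)`. -/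
def bowtieTensor : HDual k H ⊗[k] HDual k H →ₗ[k] H ⊗[k] H →ₗ[k] Double k H ⊗[k] Double k H :=
  TensorProduct.curry
    (TensorProduct.tensorTensorTensorComm k (HDual k H) (HDual k H) H H).toLinearMap

lemma comul_bowtie (ω : HDual k H) (h : H) : comul (R := k) (bowtie k H ω h) =
    bowtieTensor k H (TensorProduct.comm k _ _ (comul (R := k) ω)) (comul (R := k) h) := rfl

lemma counit_bowtie (ω : HDual k H) (h : H) : counit (R := k) (bowtie k H ω h) =
    counit (R := k) ω * counit (R := k) h := rfl

/-- Left-right Yetter-Drinfeld algebras are module algebras over the Drinfeld double. -/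
lemma IsLeftRightYD.isLeftModuleAlgebra_radfordAction {act : H →ₗ[k] X →ₗ[k] X}
    {δ : X →ₐ[k] X ⊗[k] Hᵐᵒᵖ} (h : IsLeftRightYD k H act δ) :
    IsLeftModuleAlgebra k (Double k H) (radfordAction k H act δ) := by
  have hact := h.isLeftModuleAlgebra
  have hδ : IsLeftModuleAlgebra k (HDualCop k H)
      (inducedAction (pairingCop k H) δ.toLinearMap) :=
    ((isDualPairing_pairingCop k H).isRightCoaction_iff δ).1 h.isRightCoaction
  have hex (a : H) (θ : HDual k H) (x : X) :=
    (leftRight_compat_iff_exchange act δ x).1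
      ((leftRight_compat_iff act δ x).1 fun h' => h.compat h' x) a θ
  refine ⟨fun x => ?_, fun d d' x => ?_, fun d x y => ?_, fun d => ?_⟩
  · change radfordAction k H act δ (bowtie k H 1 1) x = x
    rw [radfordAction_bowtie, hact.one_act]
    exact hδ.one_act x
  · change radfordAction k H act δ (twistedMul (exchange k H)
      (TensorProduct.tmul k (show HDual k H ⊗[k] H from d) (show HDual k H ⊗[k] H from d'))) x = _
    let act' : HDual k H ⊗[k] H →ₗ[k] X →ₗ[k] X := radfordAction k H act δ
    have hact' (ω : HDual k H) (h : H) (x : X) : act' (ω ⊗ₜ[k] h) x =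
      inducedAction (pairingOp k H) δ.toLinearMap ω (act h x) := radfordAction_tmul act δ ω h x
    have key (d d' : HDual k H ⊗[k] H) :
        act' (twistedMul (exchange k H) (d ⊗ₜ[k] d')) x = act' d (act' d' x) := by
      induction d with
      | zero => simp
      | add s t hs ht => simp only [map_add, LinearMap.add_apply, TensorProduct.add_tmul, hs, ht]
      | tmul ω a =>
      induction d' with
      | zero => simp
      | add s t hs ht => simp only [map_add, LinearMap.add_apply, TensorProduct.tmul_add, hs, ht]
      | tmul θ b =>
      -- `hex` moves `a` past `θ`; afterwards only multiplicativity of the separate actions of `Ĥ`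
      -- and `H` is needed.
      rw [twistedMul_tmul_tmul, hact', hact', hex]
      change _ = inducedAction (pairingOp k H) δ.toLinearMap ω
        (act' (exchange k H (a ⊗ₜ[k] θ)) (act b x))
      generalize exchange k H (a ⊗ₜ[k] θ) = w
      induction w with
      | zero => simp
      | add s t hs ht => simp only [map_add, LinearMap.add_apply, hs, ht]
      | tmul ω' a' =>
        rw [TensorProduct.map_tmul, hact', hact', LinearMap.mulLeft_apply,
          LinearMap.mulRight_apply, hact.mul_act]
        exact hδ.mul_act ω ω' _
    exact key d d'
  · induction d using double_induction with
    | zero => simp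
    | add d d' hd hd' => simp only [map_add, LinearMap.add_apply, hd, hd']
    | bowtie ω h =>
      rw [radfordAction_bowtie, hact.act_mul, comul_bowtie]
      generalize comul (R := k) h = z
      induction z with
      | zero => simp
      | add s t hs ht => simp only [map_add, hs, ht]
      | tmul a b =>
        refine (hδ.act_mul ω _ _).trans ?_
        change LinearMap.mul' k X (TensorProduct.map
          ((inducedAction (pairingOp k H) δ.toLinearMap).flip (act a x))
          ((inducedAction (pairingOp k H) δ.toLinearMap).flip (act b y))
            (TensorProduct.comm k _ _ (comul (R := k) ω))) = _
        generalize TensorProduct.comm k _ _ (comul (R := k) ω) = w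
        induction w with
        | zero => simp
        | add s t hs ht => simp only [map_add, LinearMap.add_apply, hs, ht]
        | tmul ω₁ ω₂ => rfl
  · induction d using double_induction with
    | zero => simp
    | add d d' hd hd' => simp only [map_add, LinearMap.add_apply, hd, hd', add_smul]
    | bowtie ω h =>
      rw [radfordAction_bowtie, hact.act_one, map_smul, counit_bowtie, mul_comm, mul_smul]
      exact congrArg _ (hδ.act_one ω)

/-- Module algebras over the Drinfeld double come from left-right Yetter-Drinfeld algebras. -/
lemma exists_isLeftRightYD {ρ : Double k H →ₗ[k] X →ₗ[k] X}
    (hρ : IsLeftModuleAlgebra k (Double k H) ρ) :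
    ∃ (act : H →ₗ[k] X →ₗ[k] X) (δ : X →ₐ[k] X ⊗[k] Hᵐᵒᵖ),
      IsLeftRightYD k H act δ ∧ radfordAction k H act δ = ρ := by
  -- The data are the restrictions of `ρ` to `1 ⋈ H` and `Ĥ ⋈ 1`. They determine `ρ` because `ω ⋈ h
  -- = (ω ⋈ 1)(1 ⋈ h)`, and the second one is converted into a coaction of `Hᵒᵖ` by duality.
  let act : H →ₗ[k] X →ₗ[k] X := ρ ∘ₗ bowtie k H 1
  let act' : HDualCop k H →ₗ[k] X →ₗ[k] X := ρ ∘ₗ (bowtie k H).flip 1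
  have hact : IsLeftModuleAlgebra k H act := by
    refine ⟨hρ.one_act, fun a b x => ?_, fun a x y => ?_, fun a => ?_⟩
    · change ρ (bowtie k H 1 (a * b)) x = ρ (bowtie k H 1 a) (ρ (bowtie k H 1 b) x)
      rw [← hρ.mul_act, one_bowtie_mul_one_bowtie]
    · refine (hρ.act_mul (bowtie k H 1 a) x y).trans ?_
      rw [comul_bowtie, comul_one_HDual, TensorProduct.comm_tmul]
      generalize comul (R := k) a = z
      induction z with
      | zero => simp
      | add s t hs ht => simp only [map_add, hs, ht]
      | tmul b c => rfl
    · refine (hρ.act_one (bowtie k H 1 a)).trans ?_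
      rw [counit_bowtie, show counit (R := k) (1 : HDual k H) = 1 from Bialgebra.counit_one,
        one_mul]
  have hact' : IsLeftModuleAlgebra k (HDualCop k H) act' := by
    have h1 (a b : HDual k H) (x : X) : ρ (bowtie k H (a * b) 1) x =
        ρ (bowtie k H a 1) (ρ (bowtie k H b 1) x) := by
      rw [← hρ.mul_act, bowtie_one_mul_bowtie_one]
    have h2 (a : HDual k H) (x y : X) : ρ (bowtie k H a 1) (x * y) =
        LinearMap.mul' k X (TensorProduct.map ((ρ ∘ₗ (bowtie k H).flip 1).flip x)
          ((ρ ∘ₗ (bowtie k H).flip 1).flip y)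
          (TensorProduct.comm k (HDual k H) (HDual k H) (comul (R := k) a))) := by
      rw [hρ.act_mul, comul_bowtie, Bialgebra.comul_one, Algebra.TensorProduct.one_def]
      generalize TensorProduct.comm k (HDual k H) (HDual k H) (comul (R := k) a) = z
      induction z with
      | zero => simp
      | add s t hs ht => simp only [map_add, LinearMap.add_apply, hs, ht]
      | tmul b c => rfl
    have h3 (a : HDual k H) : ρ (bowtie k H a 1) 1 = counit (R := k) a • (1 : X) := by
      rw [hρ.act_one, counit_bowtie, Bialgebra.counit_one, mul_one]
    exact ⟨hρ.one_act, h1, h2, h3⟩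
  obtain ⟨δ, hδ, hδact⟩ := (isDualPairing_pairingCop k H).exists_coaction hact'
  have hδact' (ω : HDual k H) (x : X) :
      inducedAction (pairingOp k H) δ.toLinearMap ω x = ρ (bowtie k H ω 1) x :=
    LinearMap.congr_fun (LinearMap.congr_fun hδact ω) x
  have hrad : radfordAction k H act δ = ρ := by
    refine LinearMap.ext fun d => LinearMap.ext fun x => ?_
    induction d using double_induction with
    | zero => simp
    | add d d' hd hd' => simp only [map_add, LinearMap.add_apply, hd, hd']
    | bowtie ω h =>
      rw [radfordAction_bowtie, hδact']
      change ρ _ (ρ (bowtie k H 1 h) x) = _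
      rw [← hρ.mul_act, bowtie_mul_one_bowtie]
  refine ⟨act, δ, ⟨hact, hδ, fun h x => ?_⟩, hrad⟩
  refine (leftRight_compat_iff act δ x).2
    ((leftRight_compat_iff_exchange act δ x).2 fun a θ => ?_) h
  rw [hδact', hrad]
  change ρ (bowtie k H 1 a) _ = _
  rw [← hρ.mul_act, one_bowtie_mul_bowtie_one]

/-- `(X, α, β)` is a right-right Yetter-Drinfeld algebra if and only if `(X, ▷_β, α)` is a
left-right Yetter-Drinfeld algebra. -/
lemma isRightRightYD_iff (α : X →ₐ[k] X ⊗[k] Hᵐᵒᵖ) (β : X →ₐ[k] X ⊗[k] HDual k H) :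
    IsRightRightYD k H α β ↔ IsLeftRightYD k H (actionOfBeta k H β) α := by
  have h := (isDualPairing_pairing k H).isRightCoaction_iff β
  constructor
  · rintro ⟨h1, h2, h3⟩
    exact ⟨h.1 h2, h1, fun a x => (leftRight_compat_iff _ α x).2
      ((rightRight_compat_iff α β).1 h3 x) a⟩
  · rintro ⟨h1, h2, h3⟩
    exact ⟨h2, h.2 h1, (rightRight_compat_iff α β).2 fun x =>
      (leftRight_compat_iff _ α x).1 fun a => h3 a x⟩

end DoubleActions

section Equivalences

variable {k : Type u} {H : Type v} [Field k] [Ring H] [HopfAlgebra k H]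

/-! ### The four functors are equivalences -/

lemma LeftRightYD.inducedAction_eq_radfordAction (X : LeftRightYD.{u, v, w} k H)
    (ω : HDual k H) (x : X.carrier) :
    inducedAction (pairingOp k H) X.coact.toLinearMap ω x =
      radfordAction k H X.act X.coact (bowtie k H ω 1) x := by
  rw [radfordAction_bowtie, X.isLeftRightYD.isLeftModuleAlgebra.one_act]

variable [FiniteDimensional k H]

variable (k H) in
lemma isLeftRightYD_actionOfBeta (X : RightRightYD.{u, v, w} k H) :
    IsLeftRightYD k H (actionOfBeta k H X.β) X.α :=
  (isRightRightYD_iff X.α X.β).1 X.isRightRightYD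

variable (k H) in
lemma isLeftModuleAlgebra_actionOfGamma
    (X : RightComoduleAlg.{u, max u v, w} k (Codouble k H)) :
    IsLeftModuleAlgebra k (Double k H) (actionOfGamma k H X.coact) :=
  ((isDualPairing_pairingDouble k H).isRightCoaction_iff X.coact).1 X.isRightCoaction

variable (k H) in
-- Coassociativity of `γ` is not computed directly: by duality it suffices that the induced action
-- of the double is a module algebra structure, and that action is Radford's.
lemma isRightCoaction_gamma (X : RightRightYD.{u, v, w} k H) :
    IsRightCoaction k (Codouble k H) (gamma k H X.α X.β) := by
  refine ((isDualPairing_pairingDouble k H).isRightCoaction_iff _).2 ?_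
  change IsLeftModuleAlgebra k (Double k H) (actionOfGamma k H (gamma k H X.α X.β))
  rw [actionOfGamma_gamma]
  exact (isLeftRightYD_actionOfBeta k H X).isLeftModuleAlgebra_radfordAction

lemma functorBeta_isEquivalence
    (wd : ∀ X : RightRightYD.{u, v, w} k H, IsLeftRightYD k H (actionOfBeta k H X.β) X.α) :
    (functorBeta wd).IsEquivalence where
  faithful := ⟨fun h => RightRightYD.Hom.ext (congrArg LeftRightYD.Hom.hom h)⟩
  full := ⟨fun g => ⟨⟨g.hom, g.comm_coact,
    (isDualPairing_pairing k H).coact_comm g.hom g.comm_act⟩, rfl⟩⟩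
  essSurj := ⟨fun Y => by
    obtain @⟨X, _, _, act, α, h⟩ := Y
    obtain ⟨β, -, rfl⟩ := (isDualPairing_pairing k H).exists_coaction h.isLeftModuleAlgebra
    -- The given action has been replaced by one induced by `β`, so the preimage maps to the object
    -- itself and not just to an isomorphic one.
    exact ⟨⟨X, α, β, (isRightRightYD_iff α β).2 h⟩, ⟨eqToIso rfl⟩⟩⟩

lemma functorGamma_isEquivalence
    (wd : ∀ X : RightComoduleAlg.{u, max u v, w} k (Codouble k H),
      IsLeftModuleAlgebra k (Double k H) (actionOfGamma k H X.coact)) :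
    (functorGamma wd).IsEquivalence where
  faithful := ⟨fun h => RightComoduleAlg.Hom.ext (congrArg LeftModuleAlg.Hom.hom h)⟩
  full := ⟨fun g => ⟨⟨g.hom,
    (isDualPairing_pairingDouble k H).coact_comm g.hom g.comm⟩, rfl⟩⟩
  essSurj := ⟨fun Y => by
    obtain @⟨X, _, _, act, h⟩ := Y
    obtain ⟨γ, hγ, rfl⟩ := (isDualPairing_pairingDouble k H).exists_coaction h
    exact ⟨⟨X, γ, hγ⟩, ⟨eqToIso rfl⟩⟩⟩

/-- The unit of `Ĥ` acts trivially by counitality of the coaction. Together with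
`inducedAction_eq_radfordAction` this recovers both structures from the action of the double, and so
gives fullness of `functorER`. -/
lemma LeftRightYD.act_eq_radfordAction (X : LeftRightYD.{u, v, w} k H) (h : H) (x : X.carrier) :
    X.act h x = radfordAction k H X.act X.coact (bowtie k H 1 h) x := by
  rw [radfordAction_bowtie]
  exact ((((isDualPairing_pairingCop k H).isRightCoaction_iff X.coact).1
    X.isLeftRightYD.isRightCoaction).one_act _).symm

lemma LeftRightYD.comm_act_of_radfordAction {X Y : LeftRightYD.{u, v, w} k H}
    (f : X.carrier →ₐ[k] Y.carrier)
    (hf : ∀ (d : Double k H) (x : X.carrier), f (radfordAction k H X.act X.coact d x) =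
      radfordAction k H Y.act Y.coact d (f x)) (h : H) (x : X.carrier) :
    f (X.act h x) = Y.act h (f x) := by
  rw [X.act_eq_radfordAction, Y.act_eq_radfordAction, hf]

lemma LeftRightYD.comm_coact_of_radfordAction {X Y : LeftRightYD.{u, v, w} k H}
    (f : X.carrier →ₐ[k] Y.carrier)
    (hf : ∀ (d : Double k H) (x : X.carrier), f (radfordAction k H X.act X.coact d x) =
      radfordAction k H Y.act Y.coact d (f x)) :
    f.toLinearMap.rTensor Hᵐᵒᵖ ∘ₗ X.coact.toLinearMap = Y.coact.toLinearMap ∘ₗ f.toLinearMap := by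
  have h (ω : HDual k H) (x : X.carrier) :
      f (inducedAction (pairingOp k H) X.coact.toLinearMap ω x) =
        inducedAction (pairingOp k H) Y.coact.toLinearMap ω (f x) := by
    rw [X.inducedAction_eq_radfordAction, Y.inducedAction_eq_radfordAction, hf]
  exact (isDualPairing_pairingCop k H).coact_comm f h

lemma functorER_isEquivalence
    (wd : ∀ X : LeftRightYD.{u, v, w} k H,
      IsLeftModuleAlgebra k (Double k H) (radfordAction k H X.act X.coact)) :
    (functorER wd).IsEquivalence where
  faithful := ⟨fun h => LeftRightYD.Hom.ext (congrArg LeftModuleAlg.Hom.hom h)⟩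
  full := ⟨fun g => ⟨⟨g.hom, LeftRightYD.comm_act_of_radfordAction g.hom g.comm,
    LeftRightYD.comm_coact_of_radfordAction g.hom g.comm⟩, rfl⟩⟩
  essSurj := ⟨fun Y => by
    obtain @⟨X, _, _, act, h⟩ := Y
    obtain ⟨act, δ, hYD, rfl⟩ := exists_isLeftRightYD h
    exact ⟨⟨X, act, δ, hYD⟩, ⟨eqToIso rfl⟩⟩⟩

/-- The functor to module algebras that is the identity on algebras and on morphisms, and is given
by a family of natural actions. -/
def actionFunctor (act : ∀ X : RightRightYD.{u, v, w} k H,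
      Double k H →ₗ[k] X.carrier →ₗ[k] X.carrier)
    (wd : ∀ X, IsLeftModuleAlgebra k (Double k H) (act X))
    (nat : ∀ {X Y : RightRightYD.{u, v, w} k H} (f : X ⟶ Y) (d : Double k H) (x : X.carrier),
      RightRightYD.Hom.hom f (act X d x) = act Y d (RightRightYD.Hom.hom f x)) :
    RightRightYD.{u, v, w} k H ⥤ LeftModuleAlg.{u, max u v, w} k (Double k H) where
  obj X := ⟨X.carrier, act X, wd X⟩
  map f := ⟨RightRightYD.Hom.hom f, nat f⟩

/-- Reduces a strict equality of functors to an equality of families of actions on fixed carriers,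
which avoids transporting morphisms along equalities of objects. Both composites of the square are
definitionally of the form `actionFunctor`. -/
lemma actionFunctor_congr {act act' : ∀ X : RightRightYD.{u, v, w} k H,
      Double k H →ₗ[k] X.carrier →ₗ[k] X.carrier} (h : act = act')
    (wd : ∀ X, IsLeftModuleAlgebra k (Double k H) (act X))
    (wd' : ∀ X, IsLeftModuleAlgebra k (Double k H) (act' X))
    (nat : ∀ {X Y : RightRightYD.{u, v, w} k H} (f : X ⟶ Y) (d : Double k H) (x : X.carrier),
      RightRightYD.Hom.hom f (act X d x) = act Y d (RightRightYD.Hom.hom f x))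
    (nat' : ∀ {X Y : RightRightYD.{u, v, w} k H} (f : X ⟶ Y) (d : Double k H) (x : X.carrier),
      RightRightYD.Hom.hom f (act' X d x) = act' Y d (RightRightYD.Hom.hom f x)) :
    actionFunctor act wd nat = actionFunctor act' wd' nat' := by
  subst h
  rfl

lemma functorER'_comp_functorGamma
    (wd_ER' : ∀ X : RightRightYD.{u, v, w} k H,
      IsRightCoaction k (Codouble k H) (gamma k H X.α X.β))
    (wd_beta : ∀ X : RightRightYD.{u, v, w} k H,
      IsLeftRightYD k H (actionOfBeta k H X.β) X.α)
    (wd_gamma : ∀ X : RightComoduleAlg.{u, max u v, w} k (Codouble k H),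
      IsLeftModuleAlgebra k (Double k H) (actionOfGamma k H X.coact))
    (wd_ER : ∀ X : LeftRightYD.{u, v, w} k H,
      IsLeftModuleAlgebra k (Double k H) (radfordAction k H X.act X.coact)) :
    functorER' wd_ER' ⋙ functorGamma wd_gamma = functorBeta wd_beta ⋙ functorER wd_ER :=
  actionFunctor_congr (act := fun X => actionOfGamma k H (gamma k H X.α X.β))
    (act' := fun X => radfordAction k H (actionOfBeta k H X.β) X.α)
    (funext fun X => actionOfGamma_gamma X.α X.β)
    (fun X => wd_gamma ((functorER' wd_ER').obj X))
    (fun X => wd_ER ((functorBeta wd_beta).obj X))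
    (fun f => ((functorER' wd_ER' ⋙ functorGamma wd_gamma).map f).comm)
    (fun f => ((functorBeta wd_beta ⋙ functorER wd_ER).map f).comm)

end Equivalences

end RadfordYD

end

theorem mainTheorem9 (k : Type u) (H : Type v) [Field k] [Ring H] [HopfAlgebra k H]
    [FiniteDimensional k H] :
    -- the four functors are well defined on objects
    ∃ (wd_ER' : ∀ X : RadfordYD.RightRightYD.{u, v, w} k H,
        RadfordYD.IsRightCoaction k (RadfordYD.Codouble k H) (RadfordYD.gamma k H X.α X.β))
      (wd_beta : ∀ X : RadfordYD.RightRightYD.{u, v, w} k H,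
        RadfordYD.IsLeftRightYD k H (RadfordYD.actionOfBeta k H X.β) X.α)
      (wd_gamma : ∀ X : RadfordYD.RightComoduleAlg.{u, max u v, w} k (RadfordYD.Codouble k H),
        RadfordYD.IsLeftModuleAlgebra k (RadfordYD.Double k H)
          (RadfordYD.actionOfGamma k H X.coact))
      (wd_ER : ∀ X : RadfordYD.LeftRightYD.{u, v, w} k H,
        RadfordYD.IsLeftModuleAlgebra k (RadfordYD.Double k H)
          (RadfordYD.radfordAction k H X.act X.coact)),
      -- they are equivalences of categories
      (RadfordYD.functorER' wd_ER').IsEquivalence ∧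
      (RadfordYD.functorBeta wd_beta).IsEquivalence ∧
      (RadfordYD.functorGamma wd_gamma).IsEquivalence ∧
      (RadfordYD.functorER wd_ER).IsEquivalence ∧
      -- the square of functors commutes
      RadfordYD.functorER' wd_ER' ⋙ RadfordYD.functorGamma wd_gamma =
        RadfordYD.functorBeta wd_beta ⋙ RadfordYD.functorER wd_ER := by
  have wd_ER (X : RadfordYD.LeftRightYD.{u, v, w} k H) :=
    X.isLeftRightYD.isLeftModuleAlgebra_radfordAction
  have hsq := RadfordYD.functorER'_comp_functorGamma (RadfordYD.isRightCoaction_gamma k H)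
    (RadfordYD.isLeftRightYD_actionOfBeta k H)
    (RadfordYD.isLeftModuleAlgebra_actionOfGamma k H) wd_ER
  have hBeta := RadfordYD.functorBeta_isEquivalence
    (RadfordYD.isLeftRightYD_actionOfBeta.{u, v, w} k H)
  have hGamma := RadfordYD.functorGamma_isEquivalence
    (RadfordYD.isLeftModuleAlgebra_actionOfGamma.{u, v, w} k H)
  have hER := RadfordYD.functorER_isEquivalence wd_ER
  refine ⟨_, _, _, wd_ER, ?_, hBeta, hGamma, hER, hsq⟩
  -- Two-out-of-three: the composite equals the other side of the square, which is a composite of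
  -- equivalences, and its second factor `functorGamma` is an equivalence.
  have hcomp : (RadfordYD.functorER' (RadfordYD.isRightCoaction_gamma.{u, v, w} k H) ⋙
      RadfordYD.functorGamma (RadfordYD.isLeftModuleAlgebra_actionOfGamma k H)).IsEquivalence := by
    rw [hsq]
    infer_instance
  exact Functor.isEquivalence_of_comp_right _ (RadfordYD.functorGamma _)
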